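/- Let $n\ge 1$, $T>0$, $\omega:=2\pi/T$, and let $A:\mathbb{R}\to\mathbb{C}^{n\times n}$ be a $T$-periodic matrix function with $A\in L^2([0,T],\mathbb{C}^{n\times n})$. For $k\in\mathbb{Z}$ let $a_{il,k}:=\frac1T\int_0^T a_{il}(\tau)e^{-j\omega k\tau}\,d\tau$ (where $j^2=-1$) be the Fourier coefficients of the entries of $A$. Let $\mathcal{A}$ be the block Toeplitz matrix whose $(i,l)$ block is $(a_{il,k-m})_{k,m\in\mathbb{Z}}$, and let $\mathcal{N}:=Id_n\otimes \mathrm{diag}(j\omega k,\ k\in\mathbb{Z})$. Regard $\mathcal{A}-\mathcal{N}$ as an unbounded operator on $\ell^2(\mathbb{Z},\mathbb{C}^n)$ with its maximal domain $\{X\in\ell^2:(\mathcal{A}-\mathcal{N})X\in\ell^2\}$; a number $z\in\mathbb{C}$ belongs to its spectrum when $z\mathcal{I}-(\mathcal{A}-\mathcal{N})$, from this domain to $\ell^2$, has no bounded two-sided inverse. There is a unique state transition matrix $\Phi(t,0)$ of $\dot x=A(t)x$, i.e. a unique matrix function whose columns are the solutions in the Carathéodory sense (locally absolutely continuous, satisfying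 the equation for almost every $t$) with initial values the canonical basis vectors. Let $\mu_1,\dots,\mu_n$ be the eigenvalues of $\Phi(T,0)$, repeated according to algebraic multiplicity. Then there are Floquet exponents, i.e. $\lambda_1,\dots,\lambda_n\in\mathbb{C}$ with $e^{\lambda_pT}=\mu_p$, and for every such choice (not necessarily the principal value of $\frac1T\log\mu_p$) the spectrum of $\mathcal{A}-\mathcal{N}$ is $$\sigma(\mathcal{A}-\mathcal{N})=\{\lambda_p+j\omega k:\ k\in\mathbb{Z},\ p=1,\dots,n\},$$ and every point of it is an eigenvalue. This set is unbounded and discrete (it has no cluster point in $\mathbb{C}$). All this holds whether or not $\mathcal{A}-\mathcal{N}$ is defective. -/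

import Mathlib

open Complex MeasureTheory Filter Topology
open scoped Kronecker

noncomputable section

/-- The Hilbert space `ℓ²` of square-summable complex families indexed by `ι`. -/
abbrev EllTwo (ι : Type*) : Type _ := lp (fun _ : ι => ℂ) 2

/-- The operator on `ℓ²(ι)` given by an infinite matrix `M`, on its maximal domain: the `X ∈ ℓ²`
for which all the series `∑ s, M r s * X s` converge and define an element of `ℓ²`. -/
def matrixOperator {ι : Type*} (M : Matrix ι ι ℂ) : EllTwo ι →ₗ.[ℂ] EllTwo ι where
  domain :=
    { carrier := {X | (∀ r, Summable fun s => M r s * X s) ∧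
        Memℓp (fun r => ∑' s, M r s * X s) 2}
      zero_mem' := by
        refine ⟨fun r => by simp, ?_⟩
        convert (zero_memℓp : Memℓp (fun _ : ι => (0 : ℂ)) 2) using 1
        funext r
        simp
      add_mem' := by
        rintro X Y ⟨hX, hX'⟩ ⟨hY, hY'⟩
        refine ⟨fun r => by simpa [mul_add] using (hX r).add (hY r), ?_⟩
        convert hX'.add hY' using 1
        funext r
        simp [mul_add, (hX r).tsum_add (hY r)]
      smul_mem' := by
        rintro c X ⟨hX, hX'⟩
        refine ⟨fun r => by simpa [mul_left_comm] using (hX r).mul_left c, ?_⟩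
        convert hX'.const_smul c using 1
        funext r
        simp [mul_left_comm, tsum_mul_left] }
  toFun :=
    { toFun := fun X => ⟨fun r => ∑' s, M r s * (X : EllTwo ι) s, X.2.2⟩
      map_add' := by
        intro X Y
        ext r
        have h := (X.2.1 r).tsum_add (Y.2.1 r)
        simp only [← mul_add] at h
        exact h
      map_smul' := by
        intro c X
        ext r
        simp [mul_left_comm, tsum_mul_left] }

/-- The resolvent set of an (unbounded) operator `L`: the `z` for which `z - L`, from the domain
of `L` to the whole space, has a bounded two-sided inverse. -/
def operatorResolventSet {E : Type*} [NormedAddCommGroup E] [NormedSpace ℂ E]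
    (L : E →ₗ.[ℂ] E) : Set ℂ :=
  {z | ∃ R : E →L[ℂ] E,
    (∀ y : E, ∃ h : R y ∈ L.domain, z • R y - L ⟨R y, h⟩ = y) ∧
    ∀ x : L.domain, R (z • (x : E) - L x) = x}

/-- The spectrum of an (unbounded) operator. -/
def operatorSpectrum {E : Type*} [NormedAddCommGroup E] [NormedSpace ℂ E]
    (L : E →ₗ.[ℂ] E) : Set ℂ :=
  (operatorResolventSet L)ᶜ

/-- The set of eigenvalues of an (unbounded) operator. -/
def operatorPointSpectrum {E : Type*} [NormedAddCommGroup E] [NormedSpace ℂ E]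
    (L : E →ₗ.[ℂ] E) : Set ℂ :=
  {z | ∃ x : L.domain, x ≠ 0 ∧ L x = z • (x : E)}

/-- The angular frequency `ω = 2π / T`. -/
def angularFreq (T : ℝ) : ℝ := 2 * Real.pi / T

/-- The `k`-th phasor (Fourier coefficient) of a `T`-periodic signal. -/
def phasor (T : ℝ) (a : ℝ → ℂ) (k : ℤ) : ℂ :=
  (1 / (T : ℂ)) * ∫ τ in (0 : ℝ)..T, a τ * exp (-(I * angularFreq T * k * τ))

/-- The Toeplitz matrix `(a_{k-l})`, `k, l ∈ ℤ`, of a `T`-periodic signal. -/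
def toeplitzMatrix (T : ℝ) (a : ℝ → ℂ) : Matrix ℤ ℤ ℂ :=
  Matrix.of fun k l => phasor T a (k - l)

/-- The block Toeplitz matrix `𝒜` of a `T`-periodic matrix function: its block `(i, j)` is the
Toeplitz matrix of the entry `(i, j)`. -/
def blockToeplitz {n : ℕ} (T : ℝ) (A : ℝ → Matrix (Fin n) (Fin n) ℂ) :
    Matrix (Fin n × ℤ) (Fin n × ℤ) ℂ :=
  Matrix.of fun r s => toeplitzMatrix T (fun t => A t r.1 s.1) r.2 s.2

/-- The infinite matrix `𝒩 = Id_n ⊗ diag (jωk, k ∈ ℤ)`. -/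
def harmonicDiag (n : ℕ) (T : ℝ) : Matrix (Fin n × ℤ) (Fin n × ℤ) ℂ :=
  (1 : Matrix (Fin n) (Fin n) ℂ) ⊗ₖ Matrix.diagonal fun k : ℤ => I * angularFreq T * k

/-- The harmonic state operator `𝒜 - 𝒩` on `ℓ²`. -/
def harmonicOperator {n : ℕ} (T : ℝ) (A : ℝ → Matrix (Fin n) (Fin n) ℂ) :
    EllTwo (Fin n × ℤ) →ₗ.[ℂ] EllTwo (Fin n × ℤ) :=
  matrixOperator (blockToeplitz T A - harmonicDiag n T)

/-- `x` solves `x' = A(t) x` on `ℝ` in the sense of Carathéodory. -/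
def IsCaratheodorySolution {n : ℕ} (A : ℝ → Matrix (Fin n) (Fin n) ℂ)
    (x : ℝ → Fin n → ℂ) : Prop :=
  (∀ a b : ℝ, AbsolutelyContinuousOnInterval x a b) ∧
    ∀ᵐ t : ℝ, HasDerivAt x ((A t).mulVec (x t)) t

/-- `Φ` is the state transition matrix `Φ(t, 0)` of `x' = A(t) x`: its `i`-th column is a solution
with initial value the `i`-th vector of the canonical basis. -/
def IsStateTransitionMatrix {n : ℕ} (A : ℝ → Matrix (Fin n) (Fin n) ℂ)
    (Φ : ℝ → Matrix (Fin n) (Fin n) ℂ) : Prop :=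
  ∀ i, IsCaratheodorySolution A (fun t => (Φ t).col i) ∧ (Φ 0).col i = Pi.single i 1

/-- `lam 0, …, lam (n-1)` are Floquet exponents attached to the monodromy matrix `P = Φ(T, 0)`:
the numbers `exp (T * lam p)` are the eigenvalues of `P`, with algebraic multiplicities.
No particular branch of `(1 / T) * log` is imposed. -/
def IsFloquetExponents {n : ℕ} (T : ℝ) (P : Matrix (Fin n) (Fin n) ℂ) (lam : Fin n → ℂ) : Prop :=
  (Finset.univ : Finset (Fin n)).val.map (fun p => exp (T * lam p)) = P.charpoly.roots

end

/-! Fourier series turn `𝒜 - 𝒩` into the differential operator `x ↦ A x - x'` on `T`-periodic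
functions: multiplication by `A` becomes convolution of phasors (`hasSum_phasor_mul`, an instance of
Parseval), and differentiation becomes multiplication by `jωk` (`phasor_of_isPrimitive`). The
maximal domain is the right one. If `X` and `Y = zX - (𝒜 - 𝒩)X` lie in `ℓ²`, the `L²` function `x`
with phasors `X` has formal derivative `(A - z)x + y`. This is only integrable, being built from a
product of `L²` functions, but that already makes `x` almost everywhere equal to an absolutely
continuous periodic solution (`exists_isPrimitive_of_phasor_eq`).

The homogeneous solutions are `e^{-zt} Φ(t) v`, and they are periodic exactly when `Φ(T) v = e^{zT}
v`. So `z` is an eigenvalue iff `e^{zT}` is an eigenvalue of `Φ(T)`. Otherwise `e^{zT} - Φ(T)` is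
invertible, every forcing `y` has a unique periodic response, and `z - (𝒜 - 𝒩)` is bijective. Its
inverse is bounded by the closed graph theorem, since the rows of `𝒜` are in `ℓ²`. The spectrum is
therefore the preimage of the eigenvalues of `Φ(T)` under `z ↦ e^{Tz}`; neither a branch of the
logarithm nor the Jordan structure plays a role.

The differential equations are handled in integral form (`IsPrimitive`), because the coefficients
are only locally integrable; a contraction in a Bielecki norm solves them on all of `ℝ` at once. -/

/-- `F` is a primitive of the locally integrable function `f`. -/
def IsPrimitive {E : Type*} [NormedAddCommGroup E] [NormedSpace ℝ E] (F f : ℝ → E) : Prop :=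
  (∀ a b : ℝ, IntervalIntegrable f volume a b) ∧ ∀ t, F t = F 0 + ∫ s in (0 : ℝ)..t, f s

/-! ### Primitives of locally integrable functions -/

section Primitive

variable {E : Type*} [NormedAddCommGroup E] [NormedSpace ℝ E]

theorem IsPrimitive.sub_eq {F f : ℝ → E} (h : IsPrimitive F f) (a b : ℝ) :
    F b - F a = ∫ s in a..b, f s := by
  rw [h.2 b, h.2 a, add_sub_add_left_eq_sub,
    intervalIntegral.integral_interval_sub_left (h.1 _ _) (h.1 _ _)]

theorem absolutelyContinuousOnInterval_of_dist_le {X Y : Type*} [PseudoMetricSpace X]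
    [PseudoMetricSpace Y] {F : ℝ → X} {H : ℝ → Y} {a b C : ℝ}
    (hH : AbsolutelyContinuousOnInterval H a b)
    (hd : ∀ s ∈ Set.uIcc a b, ∀ t ∈ Set.uIcc a b, dist (F s) (F t) ≤ C * dist (H s) (H t)) :
    AbsolutelyContinuousOnInterval F a b := by
  have h2 := Filter.Tendsto.const_mul C hH
  rw [mul_zero] at h2
  refine squeeze_zero' (Eventually.of_forall fun E => Finset.sum_nonneg fun i _ => dist_nonneg)
    ?_ h2
  filter_upwards [mem_inf_of_right (mem_principal_self _)] with E hE
  rw [Finset.mul_sum]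
  exact Finset.sum_le_sum fun i hi => hd _ (hE.1 i hi).1 _ (hE.1 i hi).2

theorem IsPrimitive.absolutelyContinuousOnInterval {F f : ℝ → E} (h : IsPrimitive F f)
    (a b : ℝ) : AbsolutelyContinuousOnInterval F a b := by
  have h1 : AbsolutelyContinuousOnInterval (fun x => ∫ v in a..x, ‖f v‖) a b :=
    (h.1 a b).norm.absolutelyContinuousOnInterval_intervalIntegral Set.left_mem_uIcc
  refine absolutelyContinuousOnInterval_of_dist_le (C := 1) h1 fun s _ t _ => ?_
  rw [one_mul, dist_comm, dist_eq_norm, h.sub_eq, dist_comm, Real.dist_eq,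
    intervalIntegral.integral_interval_sub_left (h.1 _ _).norm (h.1 _ _).norm]
  exact intervalIntegral.norm_integral_le_abs_integral_norm

theorem IsPrimitive.continuous {F f : ℝ → E} (h : IsPrimitive F f) : Continuous F := by
  have : F = fun t => F 0 + ∫ s in (0 : ℝ)..t, f s := funext h.2
  rw [this]
  exact continuous_const.add (intervalIntegral.continuous_primitive h.1 0)

theorem IsPrimitive.sub {F f G g : ℝ → E} (h : IsPrimitive F f) (h' : IsPrimitive G g) :
    IsPrimitive (fun t => F t - G t) (fun t => f t - g t) := by
  refine ⟨fun a b => (h.1 a b).sub (h'.1 a b), fun t => ?_⟩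
  beta_reduce
  rw [intervalIntegral.integral_sub (h.1 _ _) (h'.1 _ _), h.2 t, h'.2 t]
  abel

theorem IsPrimitive.add {F f G g : ℝ → E} (h : IsPrimitive F f) (h' : IsPrimitive G g) :
    IsPrimitive (fun t => F t + G t) (fun t => f t + g t) := by
  refine ⟨fun a b => (h.1 a b).add (h'.1 a b), fun t => ?_⟩
  beta_reduce
  rw [intervalIntegral.integral_add (h.1 _ _) (h'.1 _ _), h.2 t, h'.2 t]
  abel

theorem IsPrimitive.congr {F f g : ℝ → E} (h : IsPrimitive F f) (hfg : f =ᵐ[volume] g) :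
    IsPrimitive F g := by
  refine ⟨fun a b => (h.1 a b).congr_ae (ae_restrict_of_ae hfg), fun t => ?_⟩
  rw [h.2 t, intervalIntegral.integral_congr_ae (hfg.mono fun x hx _ => hx)]

theorem IsPrimitive.comp_add_const {F f : ℝ → E} (h : IsPrimitive F f) (c : ℝ) :
    IsPrimitive (fun t => F (t + c)) (fun t => f (t + c)) := by
  refine ⟨fun a b => by simpa using (h.1 (a + c) (b + c)).comp_add_right c, fun t => ?_⟩
  rw [intervalIntegral.integral_comp_add_right, ← h.sub_eq]
  abel

theorem IsPrimitive.pi {ι : Type*} [Fintype ι] {F f : ℝ → ι → E}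
    (h : ∀ i, IsPrimitive (fun t => F t i) (fun t => f t i)) [CompleteSpace E] :
    IsPrimitive F f := by
  have hint : ∀ a b : ℝ, IntervalIntegrable f volume a b := fun a b =>
    ⟨Integrable.of_eval fun i => ((h i).1 a b).1, Integrable.of_eval fun i => ((h i).1 a b).2⟩
  refine ⟨hint, fun t => ?_⟩
  ext i
  refine ((h i).2 t).trans ?_
  rw [Pi.add_apply]
  congr 1
  exact ((ContinuousLinearMap.proj (R := ℝ) (φ := fun _ : ι => E) i).intervalIntegral_comp_comm
    (hint 0 t))

theorem IsPrimitive.eval {ι : Type*} [Fintype ι] {F f : ℝ → ι → E} [CompleteSpace E]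
    (h : IsPrimitive F f) (i : ι) : IsPrimitive (fun t => F t i) (fun t => f t i) := by
  refine ⟨fun a b => ⟨Integrable.eval (h.1 a b).1 i, Integrable.eval (h.1 a b).2 i⟩, fun t => ?_⟩
  beta_reduce
  rw [h.2 t, Pi.add_apply]
  congr 1
  exact ((ContinuousLinearMap.proj (R := ℝ) (φ := fun _ : ι => E) i).intervalIntegral_comp_comm
    (h.1 0 t)).symm

theorem isPrimitive_integral {f : ℝ → E} (hf : ∀ a b : ℝ, IntervalIntegrable f volume a b)
    (c : E) : IsPrimitive (fun t => c + ∫ s in (0 : ℝ)..t, f s) f :=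
  ⟨hf, fun t => by simp⟩

variable [CompleteSpace E]

theorem IsPrimitive.ae_hasDerivAt {F f : ℝ → E} (h : IsPrimitive F f) :
    ∀ᵐ t : ℝ, HasDerivAt F (f t) t := by
  have h1 : ∀ᵐ t : ℝ, ∀ N : ℕ, t ∈ Set.uIcc (-(N : ℝ)) N → ∀ c ∈ Set.uIcc (-(N : ℝ)) N,
      HasDerivAt (fun x => ∫ s in c..x, f s) (f t) t :=
    ae_all_iff.2 fun N => (h.1 (-(N : ℝ)) N).ae_hasDerivAt_integral
  filter_upwards [h1] with t ht
  obtain ⟨N, hN⟩ := exists_nat_ge |t|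
  have hu : Set.uIcc (-(N : ℝ)) N = Set.Icc (-(N : ℝ)) N :=
    Set.uIcc_of_le (by linarith [abs_nonneg t])
  have h2 := (ht N (hu ▸ abs_le.1 hN) 0 (hu ▸ by simp)).const_add (F 0)
  exact h2.congr_of_eventuallyEq (Eventually.of_forall h.2)

/-- The difference of `F` and `∫ f` is absolutely continuous with derivative zero almost everywhere,
hence constant. Product and chain rules below reduce to this criterion. -/
theorem isPrimitive_of_absolutelyContinuous {F f : ℝ → E}
    (hf : ∀ a b : ℝ, IntervalIntegrable f volume a b)
    (hF : ∀ a b : ℝ, AbsolutelyContinuousOnInterval F a b)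
    (hd : ∀ᵐ t : ℝ, HasDerivAt F (f t) t) : IsPrimitive F f := by
  refine ⟨hf, fun t => ?_⟩
  have hp := isPrimitive_integral hf (0 : E)
  obtain ⟨C, hC⟩ := ((hF 0 t).sub (hp.absolutelyContinuousOnInterval 0 t)).const_of_ae_hasDerivAt_zero
    (by
      filter_upwards [hd, hp.ae_hasDerivAt] with s h1 h2 _
      simpa using h1.sub h2)
  have h0 := hC 0 Set.left_mem_uIcc
  have ht := hC t Set.right_mem_uIcc
  simp only [Pi.sub_apply, intervalIntegral.integral_same, zero_add, sub_zero] at h0 ht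
  rw [h0, ← ht, sub_add_cancel]

theorem IsPrimitive.smul {𝕜 : Type*} [RCLike 𝕜] [NormedSpace 𝕜 E] [IsScalarTower ℝ 𝕜 E]
    {U u : ℝ → 𝕜} {F f : ℝ → E} (hU : IsPrimitive U u) (hF : IsPrimitive F f) :
    IsPrimitive (fun t => U t • F t) (fun t => U t • f t + u t • F t) := by
  refine isPrimitive_of_absolutelyContinuous (fun a b => ?_)
    (fun a b => (hU.absolutelyContinuousOnInterval a b).smul (hF.absolutelyContinuousOnInterval a b)) ?_
  · exact ((hF.1 a b).continuousOn_smul hU.continuous.continuousOn).add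
      ((hU.1 a b).smul_continuousOn hF.continuous.continuousOn)
  · filter_upwards [hU.ae_hasDerivAt, hF.ae_hasDerivAt] with t h1 h2
    exact h1.smul h2

theorem isPrimitive_of_hasDerivAt {F f : ℝ → E} (h : ∀ t, HasDerivAt F (f t) t)
    (hf : Continuous f) : IsPrimitive F f := by
  refine ⟨fun a b => hf.intervalIntegrable a b, fun t => ?_⟩
  rw [intervalIntegral.integral_eq_sub_of_hasDerivAt (fun s _ => h s) (hf.intervalIntegrable 0 t)]
  abel

theorem IsPrimitive.comp {F f : ℝ → ℝ} (h : IsPrimitive F f) {φ φ' : ℝ → ℝ}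
    (hφ : ∀ x, HasDerivAt φ (φ' x) x) (hφ' : Continuous φ') :
    IsPrimitive (fun t => φ (F t)) (fun t => φ' (F t) * f t) := by
  refine isPrimitive_of_absolutelyContinuous (fun a b => ?_) (fun a b => ?_) ?_
  · exact (h.1 a b).continuousOn_mul (hφ'.comp h.continuous).continuousOn
  -- `F` maps the interval into a ball on which `φ'` is bounded, so `φ` is Lipschitz there and
  -- preserves absolute continuity.
  · obtain ⟨R, hR⟩ := (isCompact_uIcc (a := a) (b := b)).exists_bound_of_continuousOn
      h.continuous.continuousOn
    obtain ⟨C, hC⟩ := (isCompact_closedBall (0 : ℝ) R).exists_bound_of_continuousOn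
      hφ'.continuousOn
    refine absolutelyContinuousOnInterval_of_dist_le (C := C)
      (h.absolutelyContinuousOnInterval a b) fun s hs t ht => ?_
    rw [dist_eq_norm, dist_eq_norm]
    exact (convex_closedBall (0 : ℝ) R).norm_image_sub_le_of_norm_hasDerivWithin_le
      (fun x _ => (hφ x).hasDerivWithinAt) hC
      (mem_closedBall_zero_iff.2 (hR t ht)) (mem_closedBall_zero_iff.2 (hR s hs))
  · filter_upwards [h.ae_hasDerivAt] with t ht
    exact (hφ _).comp t ht

end Primitive

/-! ### Linear differential equations with locally integrable coefficients -/

section LinearODE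

variable {E : Type*} [NormedAddCommGroup E] [NormedSpace ℝ E] [NormedSpace ℂ E]

/-- The weight `cosh (2 ∫₀ᵗ g)` of the Bielecki norm. -/
noncomputable def coshWeight (g : ℝ → ℝ) (t : ℝ) : ℝ := Real.cosh (2 * ∫ s in (0 : ℝ)..t, g s)

theorem coshWeight_pos (g : ℝ → ℝ) (t : ℝ) : 0 < coshWeight g t := Real.cosh_pos _

theorem abs_sinh_le_cosh (x : ℝ) : |Real.sinh x| ≤ Real.cosh x :=
  abs_le.2 ⟨by rw [← Real.cosh_neg x, neg_le, ← Real.sinh_neg]; exact (Real.sinh_lt_cosh _).le,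
    (Real.sinh_lt_cosh x).le⟩

theorem continuous_coshWeight {g : ℝ → ℝ} (hg : ∀ a b : ℝ, IntervalIntegrable g volume a b) :
    Continuous (coshWeight g) :=
  Real.continuous_cosh.comp (continuous_const.mul (intervalIntegral.continuous_primitive hg 0))

theorem intervalIntegrable_mul_coshWeight {g : ℝ → ℝ}
    (hg : ∀ a b : ℝ, IntervalIntegrable g volume a b) (a b : ℝ) :
    IntervalIntegrable (fun s => g s * coshWeight g s) volume a b :=
  (hg a b).mul_continuousOn (continuous_coshWeight hg).continuousOn

/-- With `G = ∫ g`, the integrand is the derivative of `sinh (2G) / 2`, and `|sinh| ≤ cosh`. The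
factor `1/2` is the contraction constant used below; `cosh` in place of an exponential treats both
time directions together. -/
theorem abs_integral_mul_coshWeight_le {g : ℝ → ℝ}
    (hg : ∀ a b : ℝ, IntervalIntegrable g volume a b) (t : ℝ) :
    |∫ s in (0 : ℝ)..t, g s * coshWeight g s| ≤ coshWeight g t / 2 := by
  have hp := (isPrimitive_integral hg 0).comp (φ := fun x => Real.sinh (2 * x) / 2)
    (φ' := fun x => Real.cosh (2 * x)) (fun x => by
      have := ((((hasDerivAt_id x).const_mul 2).sinh).div_const 2)
      simpa using this) (by fun_prop)
  have h2 := hp.sub_eq 0 t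
  simp only [zero_add, intervalIntegral.integral_same, mul_zero, Real.sinh_zero, zero_div,
    sub_zero] at h2
  simp only [coshWeight]
  simp_rw [mul_comm (g _)]
  rw [← h2, abs_div, abs_two]
  gcongr
  exact abs_sinh_le_cosh _

theorem abs_integral_le_coshWeight {g : ℝ → ℝ} (t : ℝ) :
    |∫ s in (0 : ℝ)..t, g s| ≤ coshWeight g t := by
  set x := ∫ s in (0 : ℝ)..t, g s
  have h1 : |x| ≤ |Real.sinh (2 * x)| := by
    rw [Real.abs_sinh, abs_mul, abs_two]
    exact le_trans (by linarith [abs_nonneg x])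
      (Real.self_le_sinh_iff.2 (mul_nonneg two_pos.le (abs_nonneg x)))
  exact h1.trans (abs_sinh_le_cosh _)

theorem intervalIntegrable_clm_apply {E : Type*} [NormedAddCommGroup E] [NormedSpace ℂ E]
    {A : ℝ → E →L[ℂ] E} {y : ℝ → E} {a b : ℝ}
    (hA : IntervalIntegrable A volume a b) (hy : Continuous y) :
    IntervalIntegrable (fun s => A s (y s)) volume a b := by
  obtain ⟨C, hC⟩ := (isCompact_uIcc (a := a) (b := b)).exists_bound_of_continuousOn
    hy.continuousOn
  refine (hA.norm.mul_const C).mono_fun' ?_ ?_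
  · exact isBoundedBilinearMap_apply (𝕜 := ℂ).continuous.comp_aestronglyMeasurable
      (hA.def'.aestronglyMeasurable.prodMk hy.aestronglyMeasurable)
  · refine (ae_restrict_iff' measurableSet_uIoc).2 (Eventually.of_forall fun s hs => ?_)
    exact ((A s).le_opNorm _).trans
      (mul_le_mul_of_nonneg_left (hC s (Set.uIoc_subset_uIcc hs)) (norm_nonneg _))

theorem linearODE_unique_zero {A : ℝ → E →L[ℂ] E}
    (hA : ∀ a b : ℝ, IntervalIntegrable A volume a b) {w : ℝ → E}
    (hw : IsPrimitive w (fun t => A t (w t))) (h0 : w 0 = 0) : w = 0 := by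
  funext t₀
  set g : ℝ → ℝ := fun t => ‖A t‖
  have hg : ∀ a b : ℝ, IntervalIntegrable g volume a b := fun a b => (hA a b).norm
  -- At a maximum point of the weighted norm, the integral equation gives `M ≤ M / 2`. The interval
  -- is symmetric about `0`, so it contains the path of integration from `0` to `t₁`.
  obtain ⟨t₁, ht₁, hmax⟩ := (isCompact_Icc (a := -|t₀|) (b := |t₀|)).exists_isMaxOn
    ⟨t₀, abs_le.1 le_rfl⟩ (f := fun t => ‖w t‖ / coshWeight g t)
    (hw.continuous.norm.div₀ (continuous_coshWeight hg)
      fun t => (coshWeight_pos g t).ne').continuousOn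
  set M := ‖w t₁‖ / coshWeight g t₁ with hM
  have hle : ∀ s ∈ Set.Icc (-|t₀|) |t₀|, ‖w s‖ ≤ M * coshWeight g s := fun s hs =>
    (div_le_iff₀ (coshWeight_pos g s)).1 (hmax hs)
  have hsub : Set.uIoc 0 t₁ ⊆ Set.Icc (-|t₀|) |t₀| :=
    Set.uIoc_subset_uIcc.trans (Set.uIcc_subset_Icc (by simp) ht₁)
  have h1 : ‖w t₁‖ ≤ M * (coshWeight g t₁ / 2) := by
    rw [hw.2 t₁, h0, zero_add]
    calc ‖∫ s in (0 : ℝ)..t₁, A s (w s)‖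
        ≤ |∫ s in (0 : ℝ)..t₁, M * (g s * coshWeight g s)| := by
          refine intervalIntegral.norm_integral_le_abs_of_norm_le ?_
            ((intervalIntegrable_mul_coshWeight hg _ _).const_mul _)
          refine (ae_restrict_iff' measurableSet_uIoc).2 (Eventually.of_forall fun s hs => ?_)
          calc ‖A s (w s)‖ ≤ ‖A s‖ * ‖w s‖ := (A s).le_opNorm _
            _ ≤ g s * (M * coshWeight g s) :=
              mul_le_mul_of_nonneg_left (hle s (hsub hs)) (norm_nonneg _)
            _ = _ := by ring
      _ = M * |∫ s in (0 : ℝ)..t₁, g s * coshWeight g s| := by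
          rw [intervalIntegral.integral_const_mul, abs_mul,
            abs_of_nonneg (div_nonneg (norm_nonneg _) (coshWeight_pos g t₁).le)]
      _ ≤ _ := mul_le_mul_of_nonneg_left (abs_integral_mul_coshWeight_le hg t₁)
          (div_nonneg (norm_nonneg _) (coshWeight_pos g t₁).le)
  have h2 : ‖w t₁‖ = M * coshWeight g t₁ := by
    rw [hM, div_mul_cancel₀ _ (coshWeight_pos g t₁).ne']
  have h3 : M ≤ 0 := by
    have := coshWeight_pos g t₁
    by_contra hlt
    nlinarith [mul_pos (not_le.1 hlt) this]
  have h4 := hle t₀ (abs_le.1 le_rfl)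
  exact norm_le_zero_iff.1 (h4.trans (mul_nonpos_of_nonpos_of_nonneg h3 (coshWeight_pos g t₀).le))

theorem linearODE_unique {A : ℝ → E →L[ℂ] E}
    (hA : ∀ a b : ℝ, IntervalIntegrable A volume a b) {f u w : ℝ → E}
    (hu : IsPrimitive u (fun t => A t (u t) + f t))
    (hw : IsPrimitive w (fun t => A t (w t) + f t)) (h0 : u 0 = w 0) : u = w := by
  have h := hu.sub hw
  have := linearODE_unique_zero hA (w := fun t => u t - w t) (by simpa using h) (by simp [h0])
  funext t
  exact sub_eq_zero.1 (congrFun this t)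

/-- Picard iteration for `y = u / W`, with `W` the weight: in this unknown the integral operator
preserves the bounded continuous functions on `ℝ` and halves distances. -/
theorem linearODE_exists [CompleteSpace E] {A : ℝ → E →L[ℂ] E}
    (hA : ∀ a b : ℝ, IntervalIntegrable A volume a b) {f : ℝ → E}
    (hf : ∀ a b : ℝ, IntervalIntegrable f volume a b) (v : E) :
    ∃ u : ℝ → E, u 0 = v ∧ IsPrimitive u (fun t => A t (u t) + f t) := by
  -- Including `‖f‖` makes `W` dominate the forcing term `∫ f` as well.
  set g : ℝ → ℝ := fun t => ‖A t‖ + ‖f t‖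
  have hg : ∀ a b : ℝ, IntervalIntegrable g volume a b := fun a b => (hA a b).norm.add (hf a b).norm
  set W := coshWeight g
  have hWc : Continuous W := continuous_coshWeight hg
  have hWp : ∀ t, 0 < W t := coshWeight_pos g
  have hint : ∀ y : BoundedContinuousFunction ℝ E, ∀ a b : ℝ,
      IntervalIntegrable (fun s => A s (W s • y s) + f s) volume a b := fun y a b =>
    (intervalIntegrable_clm_apply (hA a b) (hWc.smul y.continuous)).add (hf a b)
  have hbd : ∀ (z : ℝ → E) (C : ℝ), (∀ s, ‖z s‖ ≤ C) → 0 ≤ C → ∀ t,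
      ‖∫ s in (0 : ℝ)..t, A s (W s • z s)‖ ≤ C * (W t / 2) := by
    intro z C hz hC t
    calc ‖∫ s in (0 : ℝ)..t, A s (W s • z s)‖
        ≤ |∫ s in (0 : ℝ)..t, C * (g s * W s)| := by
          refine intervalIntegral.norm_integral_le_abs_of_norm_le
            (Eventually.of_forall fun s => ?_)
            ((intervalIntegrable_mul_coshWeight hg _ _).const_mul _)
          calc ‖A s (W s • z s)‖ ≤ ‖A s‖ * ‖W s • z s‖ := (A s).le_opNorm _
            _ = ‖A s‖ * (W s * ‖z s‖) := by rw [norm_smul, Real.norm_of_nonneg (hWp s).le]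
            _ ≤ g s * (W s * C) := by
              have := hWp s
              gcongr
              · exact le_add_of_nonneg_right (norm_nonneg _)
              · exact hz s
            _ = _ := by ring
      _ = C * |∫ s in (0 : ℝ)..t, g s * W s| := by
          rw [intervalIntegral.integral_const_mul, abs_mul, abs_of_nonneg hC]
      _ ≤ _ := mul_le_mul_of_nonneg_left (abs_integral_mul_coshWeight_le hg t) hC
  have hfbd : ∀ t, ‖∫ s in (0 : ℝ)..t, f s‖ ≤ W t := fun t =>
    (intervalIntegral.norm_integral_le_abs_of_norm_le (g := g)
      (Eventually.of_forall fun s => le_add_of_nonneg_left (norm_nonneg _)) (hg 0 t)).trans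
      (abs_integral_le_coshWeight t)
  have hW1 : ∀ t, 1 ≤ W t := fun t => Real.one_le_cosh _
  let P : BoundedContinuousFunction ℝ E → BoundedContinuousFunction ℝ E := fun y =>
    BoundedContinuousFunction.ofNormedAddCommGroup
      (fun t => (W t)⁻¹ • (v + ∫ s in (0 : ℝ)..t, (A s (W s • y s) + f s)))
      ((hWc.inv₀ fun t => (hWp t).ne').smul
        (continuous_const.add (intervalIntegral.continuous_primitive (hint y) 0)))
      (‖v‖ + ‖y‖ + 1) (fun t => by
        rw [norm_smul, norm_inv, Real.norm_of_nonneg (hWp t).le, inv_mul_le_iff₀ (hWp t),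
          intervalIntegral.integral_add (f := fun s => A s (W s • y s))
            (intervalIntegrable_clm_apply (hA 0 t) (hWc.smul y.continuous)) (hf 0 t)]
        have h1 := hbd y ‖y‖ y.norm_coe_le_norm (norm_nonneg _) t
        have h2 := norm_add_le v ((∫ s in (0 : ℝ)..t, A s (W s • y s)) + ∫ s in (0 : ℝ)..t, f s)
        have h3 := norm_add_le (∫ s in (0 : ℝ)..t, A s (W s • y s)) (∫ s in (0 : ℝ)..t, f s)
        nlinarith [hfbd t, hW1 t, norm_nonneg v, norm_nonneg y])
  have hP : ContractingWith (1 / 2) P := by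
    refine ⟨by norm_num, LipschitzWith.of_dist_le_mul fun y z => ?_⟩
    refine (BoundedContinuousFunction.dist_le (by positivity)).2 fun t => ?_
    change dist ((W t)⁻¹ • (v + ∫ s in (0 : ℝ)..t, (A s (W s • y s) + f s)))
      ((W t)⁻¹ • (v + ∫ s in (0 : ℝ)..t, (A s (W s • z s) + f s))) ≤ _
    rw [dist_smul₀, dist_add_left, dist_eq_norm,
      ← intervalIntegral.integral_sub (hint y 0 t) (hint z 0 t), norm_inv,
      Real.norm_of_nonneg (hWp t).le, inv_mul_le_iff₀ (hWp t)]
    have h1 := hbd (fun s => y s - z s) (dist y z)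
      (fun s => by rw [← dist_eq_norm]; exact BoundedContinuousFunction.dist_coe_le_dist s)
      dist_nonneg t
    simp only [smul_sub, map_sub] at h1
    simp only [add_sub_add_right_eq_sub]
    refine h1.trans (le_of_eq ?_)
    push_cast
    ring
  set y := hP.fixedPoint P
  have hfix : P y = y := hP.fixedPoint_isFixedPt
  have key : ∀ t, W t • y t = v + ∫ s in (0 : ℝ)..t, (A s (W s • y s) + f s) := fun t => by
    conv_lhs => rw [← hfix]
    exact smul_inv_smul₀ (hWp t).ne' _
  refine ⟨fun t => W t • y t, by simp [key 0], hint y, fun t => ?_⟩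
  have h0 := key 0
  rw [intervalIntegral.integral_same, add_zero] at h0
  beta_reduce
  rw [h0, key t]

end LinearODE

/-! ### Fourier coefficients of square integrable and of absolutely continuous functions -/

section Phasor

variable {T : ℝ}

theorem fourier_neg_coe (hT : 0 < T) (k : ℤ) (t : ℝ) :
    fourier (-k) (t : AddCircle T) = exp (-(I * angularFreq T * k * t)) := by
  rw [fourier_coe_apply]
  congr 1
  simp only [angularFreq]
  push_cast
  have : (T : ℂ) ≠ 0 := by exact_mod_cast hT.ne'
  field_simp

theorem phasor_congr (hT : 0 < T) {a b : ℝ → ℂ} (h : a =ᵐ[volume.restrict (Set.Ioc 0 T)] b)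
    (k : ℤ) : phasor T a k = phasor T b k := by
  unfold phasor
  rw [intervalIntegral.integral_of_le hT.le, intervalIntegral.integral_of_le hT.le]
  congr 1
  exact integral_congr_ae (h.mono fun t ht => by simp only [ht])

theorem phasor_eq_fourierCoeff [hT : Fact (0 < T)] (F : AddCircle T → ℂ) {f : ℝ → ℂ}
    (h : ∀ t ∈ Set.Ioc 0 T, F t = f t) (k : ℤ) : phasor T f k = fourierCoeff F k := by
  rw [fourierCoeff_eq_intervalIntegral F k 0, phasor, zero_add, Complex.real_smul]
  push_cast
  congr 1
  refine intervalIntegral.integral_congr_ae (Eventually.of_forall fun t ht => ?_)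
  rw [Set.uIoc_of_le hT.out.le] at ht
  rw [fourier_neg_coe hT.out, h t ht, smul_eq_mul, mul_comm]

theorem phasor_eq_fourierCoeff_liftIoc [hT : Fact (0 < T)] (f : ℝ → ℂ) (k : ℤ) :
    phasor T f k = fourierCoeff (AddCircle.liftIoc T 0 f) k :=
  phasor_eq_fourierCoeff _ (fun t ht => AddCircle.liftIoc_coe_apply (by simpa using ht)) k

theorem memLp_liftIoc_haar [hT : Fact (0 < T)] {f : ℝ → ℂ}
    (hf : MemLp f 2 (volume.restrict (Set.Ioc 0 T))) :
    MemLp (AddCircle.liftIoc T 0 f) 2 (AddCircle.haarAddCircle (T := T)) :=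
  memLp_haarAddCircle_iff.2 (MemLp.memLp_liftIoc (by simpa using hf))

theorem memℓp_phasor (hT : 0 < T) {f : ℝ → ℂ} (hf : MemLp f 2 (volume.restrict (Set.Ioc 0 T))) :
    Memℓp (phasor T f) 2 := by
  have : Fact (0 < T) := ⟨hT⟩
  have h := lp.memℓp (fourierBasis.repr ((memLp_liftIoc_haar hf).toLp _))
  have e : phasor T f = fourierBasis.repr ((memLp_liftIoc_haar hf).toLp _) := funext fun k => by
    rw [fourierBasis_repr, phasor_eq_fourierCoeff_liftIoc,
      fourierCoeff_congr_ae (MemLp.coeFn_toLp _)]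
  rw [e]
  exact h

/-- Riesz–Fischer; composing with the projection to the circle gives a representative that is
periodic at every point. -/
theorem exists_phasor_eq (hT : 0 < T) {X : ℤ → ℂ} (hX : Memℓp X 2) :
    ∃ x : ℝ → ℂ, Function.Periodic x T ∧ MemLp x 2 (volume.restrict (Set.Ioc 0 T)) ∧
      ∀ k, phasor T x k = X k := by
  have : Fact (0 < T) := ⟨hT⟩
  let X' : lp (fun _ : ℤ => ℂ) 2 := ⟨X, hX⟩
  let F := (fourierBasis (T := T)).repr.symm X'
  refine ⟨fun t => F (t : AddCircle T), fun t => by simp, ?_, fun k => ?_⟩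
  · have h := (memLp_haarAddCircle_iff.1 (Lp.memLp F)).comp_measurePreserving
      (AddCircle.measurePreserving_mk T 0)
    rw [zero_add] at h
    exact h
  · rw [phasor_eq_fourierCoeff F (fun _ _ => rfl), ← fourierBasis_repr]
    simp [F, X']

/-- Parseval for the inner product of `conj (e_{-k} a)` with `x`: the pairing of the former with
`e_m` is the phasor of `a` at `k - m`. The product `a x` itself need not be square integrable. -/
theorem hasSum_phasor_mul (hT : 0 < T) {a x : ℝ → ℂ}
    (ha : MemLp a 2 (volume.restrict (Set.Ioc 0 T)))
    (hx : MemLp x 2 (volume.restrict (Set.Ioc 0 T))) (k : ℤ) :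
    HasSum (fun m => phasor T a (k - m) * phasor T x m) (phasor T (fun t => a t * x t) k) := by
  have : Fact (0 < T) := ⟨hT⟩
  set a' := AddCircle.liftIoc T 0 a
  have hb : MemLp (fun t => star (fourier (-k) t * a' t)) 2 (AddCircle.haarAddCircle (T := T)) := by
    have h1 : MemLp (fun t => fourier (-k) t * a' t) 2 (AddCircle.haarAddCircle (T := T)) := by
      refine (memLp_liftIoc_haar ha).of_le ?_ (Eventually.of_forall fun t => ?_)
      · exact (map_continuous (fourier (-k))).aestronglyMeasurable.mul
          (memLp_liftIoc_haar ha).1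
      · rw [norm_mul, fourier_apply, Circle.norm_coe, one_mul]
    exact h1.star
  have h := (fourierBasis (T := T)).hasSum_inner_mul_inner (hb.toLp _)
    ((memLp_liftIoc_haar hx).toLp _)
  have h1 : inner ℂ (hb.toLp _) ((memLp_liftIoc_haar hx).toLp _)
      = phasor T (fun t => a t * x t) k := by
    rw [L2.inner_def, phasor_eq_fourierCoeff_liftIoc, fourierCoeff]
    refine integral_congr_ae ?_
    filter_upwards [hb.coeFn_toLp, (memLp_liftIoc_haar hx).coeFn_toLp] with t h1 h2
    rw [h1, h2]
    simp only [RCLike.inner_apply', smul_eq_mul, starRingEnd_apply, star_star]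
    rw [mul_assoc]
    rfl
  rw [h1] at h
  refine h.congr_fun fun m => ?_
  congr 1
  · rw [coe_fourierBasis, L2.inner_def, phasor_eq_fourierCoeff_liftIoc, fourierCoeff]
    refine integral_congr_ae ?_
    filter_upwards [hb.coeFn_toLp, coeFn_fourierLp 2 m] with t h1 h2
    rw [h1, h2]
    simp only [RCLike.inner_apply', smul_eq_mul, starRingEnd_apply, star_star]
    rw [neg_sub, sub_eq_add_neg, fourier_add]
    ring
  · rw [← HilbertBasis.repr_apply_apply, fourierBasis_repr,
      fourierCoeff_congr_ae (MemLp.coeFn_toLp _), phasor_eq_fourierCoeff_liftIoc]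

theorem ae_eq_zero_of_phasor_eq_zero (hT : 0 < T) {f : ℝ → ℂ}
    (hf : MemLp f 2 (volume.restrict (Set.Ioc 0 T))) (h : ∀ k, phasor T f k = 0) :
    f =ᵐ[volume.restrict (Set.Ioc 0 T)] 0 := by
  have : Fact (0 < T) := ⟨hT⟩
  have h0 : (memLp_liftIoc_haar hf).toLp _ = 0 := by
    refine (fourierBasis (T := T)).repr.injective ?_
    ext k
    rw [fourierBasis_repr, fourierCoeff_congr_ae (MemLp.coeFn_toLp _),
      ← phasor_eq_fourierCoeff_liftIoc, h k]
    simp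
  have h1 : AddCircle.liftIoc T 0 f =ᵐ[AddCircle.haarAddCircle] 0 :=
    (memLp_liftIoc_haar hf).coeFn_toLp.symm.trans (h0 ▸ Lp.coeFn_zero _ _ _)
  have h2 : ∀ᵐ z : AddCircle T, AddCircle.liftIoc T 0 f z = 0 := by
    rw [AddCircle.volume_eq_smul_haarAddCircle]
    exact Measure.ae_smul_measure h1 _
  have h3 := (AddCircle.measurePreserving_mk T 0).quasiMeasurePreserving.ae h2
  rw [zero_add] at h3
  filter_upwards [h3, ae_restrict_mem measurableSet_Ioc] with t ht ht'
  rwa [AddCircle.liftIoc_coe_apply (by simpa using ht')] at ht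

theorem angularFreq_ne_zero (hT : 0 < T) : (angularFreq T : ℂ) ≠ 0 := by
  exact_mod_cast (div_pos (mul_pos two_pos Real.pi_pos) hT).ne'

theorem exp_angularFreq_mul (hT : 0 < T) (k : ℤ) : exp (I * angularFreq T * k * T) = 1 := by
  rw [Complex.exp_eq_one_iff]
  refine ⟨k, ?_⟩
  simp only [angularFreq]
  push_cast
  have : (T : ℂ) ≠ 0 := by exact_mod_cast hT.ne'
  field_simp

theorem isPrimitive_exp (c : ℂ) :
    IsPrimitive (fun t : ℝ => exp (c * t)) (fun t : ℝ => c * exp (c * t)) := by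
  refine isPrimitive_of_hasDerivAt (fun t => ?_) (by fun_prop)
  have h1 : HasDerivAt (fun s : ℝ => c * (s : ℂ)) c t := by
    simpa using (Complex.ofRealCLM.hasDerivAt (x := t)).const_mul c
  simpa [mul_comm] using h1.cexp

theorem intervalIntegrable_mul_exp {f : ℝ → ℂ} {a b : ℝ} (hf : IntervalIntegrable f volume a b)
    (c : ℂ) : IntervalIntegrable (fun t => f t * exp (-(c * t))) volume a b :=
  hf.mul_continuousOn (by fun_prop)

/-- Integration by parts over one period; `u T = u 0` cancels the boundary terms. -/
theorem phasor_of_isPrimitive (hT : 0 < T) {u u' : ℝ → ℂ} (hu : IsPrimitive u u')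
    (hper : u T = u 0) (k : ℤ) : phasor T u' k = I * angularFreq T * k * phasor T u k := by
  have he := isPrimitive_exp (-(I * angularFreq T * k))
  have h := (he.smul (𝕜 := ℂ) hu).sub_eq 0 T
  have h1 : exp (-(I * angularFreq T * k) * T) = 1 := by
    rw [neg_mul, Complex.exp_neg, exp_angularFreq_mul hT, inv_one]
  simp only [smul_eq_mul, h1, hper, ofReal_zero, mul_zero, exp_zero, sub_self] at h
  have h2 : ∀ t : ℝ, exp (-(I * angularFreq T * k) * t) * u' t
      + -(I * angularFreq T * k) * exp (-(I * angularFreq T * k) * t) * u t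
      = u' t * exp (-(I * angularFreq T * k * t))
        - (I * angularFreq T * k) * (u t * exp (-(I * angularFreq T * k * t))) := fun t => by
    rw [neg_mul]
    ring
  simp_rw [h2] at h
  rw [intervalIntegral.integral_sub (intervalIntegrable_mul_exp (hu.1 0 T) _)
    ((intervalIntegrable_mul_exp (hu.continuous.intervalIntegrable 0 T) _).const_mul _),
    intervalIntegral.integral_const_mul] at h
  rw [phasor, phasor, sub_eq_zero.1 h.symm]
  ring

theorem phasor_add {f g : ℝ → ℂ} (hf : IntervalIntegrable f volume 0 T)
    (hg : IntervalIntegrable g volume 0 T) (k : ℤ) :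
    phasor T (fun t => f t + g t) k = phasor T f k + phasor T g k := by
  simp only [phasor, add_mul]
  rw [intervalIntegral.integral_add (intervalIntegrable_mul_exp hf _)
    (intervalIntegrable_mul_exp hg _), mul_add]

theorem phasor_const_mul (c : ℂ) (f : ℝ → ℂ) (k : ℤ) :
    phasor T (fun t => c * f t) k = c * phasor T f k := by
  simp only [phasor, mul_assoc, intervalIntegral.integral_const_mul]
  ring

theorem phasor_sub {f g : ℝ → ℂ} (hf : IntervalIntegrable f volume 0 T)
    (hg : IntervalIntegrable g volume 0 T) (k : ℤ) :
    phasor T (fun t => f t - g t) k = phasor T f k - phasor T g k := by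
  simp only [phasor, sub_mul]
  rw [intervalIntegral.integral_sub (intervalIntegrable_mul_exp hf _)
    (intervalIntegrable_mul_exp hg _), mul_sub]

theorem phasor_sum {ι : Type*} (s : Finset ι) {f : ι → ℝ → ℂ}
    (hf : ∀ i ∈ s, IntervalIntegrable (f i) volume 0 T) (k : ℤ) :
    phasor T (fun t => ∑ i ∈ s, f i t) k = ∑ i ∈ s, phasor T (f i) k := by
  simp only [phasor, Finset.sum_mul]
  rw [intervalIntegral.integral_finsetSum fun i hi => intervalIntegrable_mul_exp (hf i hi) _,
    Finset.mul_sum]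

theorem phasor_const (hT : 0 < T) (c : ℂ) {k : ℤ} (hk : k ≠ 0) :
    phasor T (fun _ => c) k = 0 := by
  have h := phasor_of_isPrimitive hT (u := fun _ => c) (u' := fun _ => 0)
    ⟨fun a b => intervalIntegrable_const, fun t => by simp⟩ rfl k
  have h0 : phasor T (fun _ => 0) k = 0 := by simp [phasor]
  rw [h0, eq_comm, mul_eq_zero] at h
  refine h.resolve_left (mul_ne_zero (mul_ne_zero I_ne_zero (angularFreq_ne_zero hT)) ?_)
  exact_mod_cast hk

theorem phasor_const_zero (hT : 0 < T) (c : ℂ) : phasor T (fun _ => c) 0 = c := by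
  have : (T : ℂ) ≠ 0 := by exact_mod_cast hT.ne'
  simp [phasor, this]

theorem memLp_of_continuous {E : Type*} [NormedAddCommGroup E] {x : ℝ → E} (hx : Continuous x) :
    MemLp x 2 (volume.restrict (Set.Ioc 0 T)) := by
  obtain ⟨C, hC⟩ := (isCompact_Icc (a := 0) (b := T)).exists_bound_of_continuousOn hx.continuousOn
  exact MemLp.of_bound hx.aestronglyMeasurable.restrict C
    ((ae_restrict_iff' measurableSet_Ioc).2
      (Eventually.of_forall fun t ht => hC t (Set.Ioc_subset_Icc_self ht)))

theorem intervalIntegrable_of_memLp (hT : 0 < T) {E : Type*} [NormedAddCommGroup E] {x : ℝ → E}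
    (hx : MemLp x 2 (volume.restrict (Set.Ioc 0 T))) : IntervalIntegrable x volume 0 T :=
  (intervalIntegrable_iff_integrableOn_Ioc_of_le hT.le).2 (hx.integrable (by norm_num))

/-- A square integrable function whose formal derivative is the integrable function `f` is
almost everywhere a primitive of `f`. -/
theorem exists_isPrimitive_of_phasor_eq (hT : 0 < T) {x f : ℝ → ℂ}
    (hx : MemLp x 2 (volume.restrict (Set.Ioc 0 T)))
    (hf : ∀ a b : ℝ, IntervalIntegrable f volume a b)
    (h : ∀ k, phasor T f k = I * angularFreq T * k * phasor T x k) :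
    ∃ w : ℝ → ℂ, IsPrimitive w f ∧ w T = w 0 ∧ x =ᵐ[volume.restrict (Set.Ioc 0 T)] w := by
  -- The case `k = 0` says that `f` has mean zero, so its primitive `F` takes equal values at `0`
  -- and `T`.
  have hint : ∫ t in (0 : ℝ)..T, f t = 0 := by
    have h0 := h 0
    simp only [phasor, Int.cast_zero, mul_zero, zero_mul, neg_zero, exp_zero, mul_one] at h0
    have : (T : ℂ) ≠ 0 := by exact_mod_cast hT.ne'
    simpa [this] using h0
  have hF := isPrimitive_integral hf 0
  have hFT : (0 : ℂ) + ∫ s in (0 : ℝ)..T, f s = 0 + ∫ s in (0 : ℝ)..0, f s := by simp [hint]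
  set F : ℝ → ℂ := fun t => 0 + ∫ s in (0 : ℝ)..t, f s with hFdef
  have hFm : MemLp F 2 (volume.restrict (Set.Ioc 0 T)) := memLp_of_continuous hF.continuous
  -- The phasors of `x` and `F` agree for `k ≠ 0`, so `x - F` is almost everywhere its mean `c`.
  set c := phasor T (fun t => x t - F t) 0
  have hxi := intervalIntegrable_of_memLp hT hx
  have hFi := intervalIntegrable_of_memLp hT hFm
  have hz := ae_eq_zero_of_phasor_eq_zero hT (f := fun t => x t - F t - c)
    ((hx.sub hFm).sub (memLp_of_continuous continuous_const)) (fun k => by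
      rw [phasor_sub (hxi.sub hFi) intervalIntegrable_const]
      rcases eq_or_ne k 0 with rfl | hk
      · rw [phasor_const_zero hT, sub_self]
      · rw [phasor_const hT _ hk, sub_zero, phasor_sub hxi hFi, sub_eq_zero]
        have h1 := phasor_of_isPrimitive hT hF hFT k
        rw [h k] at h1
        refine mul_left_cancel₀ (mul_ne_zero (mul_ne_zero I_ne_zero (angularFreq_ne_zero hT)) ?_) h1
        exact_mod_cast hk)
  refine ⟨fun t => c + ∫ s in (0 : ℝ)..t, f s, isPrimitive_integral hf c, by simp [hint], ?_⟩
  filter_upwards [hz] with t ht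
  have : x t - F t - c = 0 := ht
  simp only [hFdef] at this
  linear_combination this

/-- A `T`-periodic property which holds almost everywhere on a period holds almost everywhere. -/
theorem ae_of_periodic (hT : 0 < T) {p : ℝ → Prop} (hp : Function.Periodic p T)
    (h : ∀ᵐ t ∂volume.restrict (Set.Ioc 0 T), p t) : ∀ᵐ t, p t := by
  have hd := isAddFundamentalDomain_Ioc hT 0 (μ := (volume : Measure ℝ))
  rw [zero_add] at hd
  -- The exceptional set is invariant under translation by multiples of `T`, and `(0, T]` is a
  -- fundamental domain.
  refine hd.measure_zero_of_invariant _ (fun g => ?_) ?_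
  · obtain ⟨_, n, rfl⟩ := g
    ext t
    rw [Set.mem_vadd_set_iff_neg_vadd_mem]
    have := (hp.zsmul (-n)) t
    simp only [Set.mem_compl_iff, Set.mem_ofPred_eq, AddSubgroup.vadd_def, vadd_eq_add,
      AddSubgroup.coe_neg, ← neg_smul, add_comm _ t]
    rw [this]
  · rw [ae_restrict_iff' measurableSet_Ioc] at h
    refine measure_mono_null (fun t ht => ?_) h
    simp only [Set.mem_inter_iff, Set.mem_compl_iff, Set.mem_ofPred_eq] at ht ⊢
    exact fun h => ht.1 (h ht.2)

end Phasor

/-! ### State transition matrix, monodromy and periodic solutions -/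

section StateTransition

variable {n : ℕ} {A Φ : ℝ → Matrix (Fin n) (Fin n) ℂ}

theorem IsPrimitive.sum {E ι : Type*} [NormedAddCommGroup E] [NormedSpace ℝ E] (s : Finset ι)
    {F f : ι → ℝ → E} (h : ∀ i ∈ s, IsPrimitive (F i) (f i)) :
    IsPrimitive (fun t => ∑ i ∈ s, F i t) (fun t => ∑ i ∈ s, f i t) := by
  classical
  induction s using Finset.induction_on with
  | empty => exact ⟨fun a b => by simp, fun t => by simp⟩
  | insert i s hi ih =>
    simp only [Finset.sum_insert hi]
    exact (h i (Finset.mem_insert_self i s)).add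
      (ih fun j hj => h j (Finset.mem_insert_of_mem hj))

theorem intervalIntegrable_linearMap_matrix {F : Type*} [NormedAddCommGroup F] [NormedSpace ℂ F]
    (L : Matrix (Fin n) (Fin n) ℂ →ₗ[ℂ] F) {a b : ℝ}
    (hA : ∀ i j, IntervalIntegrable (fun t => A t i j) volume a b) :
    IntervalIntegrable (fun t => L (A t)) volume a b := by
  have h : ∀ t, L (A t) = ∑ i, ∑ j, A t i j • L (Matrix.single i j 1) := fun t => by
    conv_lhs => rw [Matrix.matrix_eq_sum_single (A t)]
    simp only [map_sum, ← map_smul, Matrix.smul_single, smul_eq_mul, mul_one]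
  have h' : (fun t => L (A t)) = ∑ i, ∑ j, fun t => A t i j • L (Matrix.single i j 1) := by
    funext t
    simpa only [Finset.sum_apply] using h t
  rw [h']
  exact IntervalIntegrable.sum _ fun i _ => IntervalIntegrable.sum _ fun j _ =>
    ⟨(hA i j).1.smul_const _, (hA i j).2.smul_const _⟩

theorem intervalIntegrable_toCLM {a b : ℝ}
    (hA : ∀ i j, IntervalIntegrable (fun t => A t i j) volume a b) :
    IntervalIntegrable (fun t => (Matrix.toLin' (A t)).toContinuousLinearMap) volume a b :=
  intervalIntegrable_linearMap_matrix
    (LinearMap.toContinuousLinearMap.toLinearMap ∘ₗ Matrix.toLin'.toLinearMap) hA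

theorem intervalIntegrable_mulVec {a b : ℝ} {x : ℝ → Fin n → ℂ}
    (hA : ∀ i j, IntervalIntegrable (fun t => A t i j) volume a b) (hx : Continuous x) :
    IntervalIntegrable (fun t => (A t).mulVec (x t)) volume a b :=
  intervalIntegrable_clm_apply (intervalIntegrable_toCLM hA) hx

theorem mulVecODE_exists (hA : ∀ i j, ∀ a b : ℝ, IntervalIntegrable (fun t => A t i j) volume a b)
    {f : ℝ → Fin n → ℂ} (hf : ∀ a b : ℝ, IntervalIntegrable f volume a b) (v : Fin n → ℂ) :
    ∃ u : ℝ → Fin n → ℂ, u 0 = v ∧ IsPrimitive u (fun t => (A t).mulVec (u t) + f t) :=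
  linearODE_exists (fun a b => intervalIntegrable_toCLM fun i j => hA i j a b) hf v

theorem mulVecODE_unique (hA : ∀ i j, ∀ a b : ℝ, IntervalIntegrable (fun t => A t i j) volume a b)
    {f u w : ℝ → Fin n → ℂ} (hu : IsPrimitive u (fun t => (A t).mulVec (u t) + f t))
    (hw : IsPrimitive w (fun t => (A t).mulVec (w t) + f t)) (h0 : u 0 = w 0) : u = w :=
  linearODE_unique (fun a b => intervalIntegrable_toCLM fun i j => hA i j a b) hu hw h0

theorem mulVecODE_unique_homogeneous
    (hA : ∀ i j, ∀ a b : ℝ, IntervalIntegrable (fun t => A t i j) volume a b)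
    {u w : ℝ → Fin n → ℂ} (hu : IsPrimitive u (fun t => (A t).mulVec (u t)))
    (hw : IsPrimitive w (fun t => (A t).mulVec (w t))) (h0 : u 0 = w 0) : u = w :=
  mulVecODE_unique hA (f := 0) (by simpa using hu) (by simpa using hw) h0

theorem isCaratheodorySolution_iff
    (hA : ∀ i j, ∀ a b : ℝ, IntervalIntegrable (fun t => A t i j) volume a b)
    {x : ℝ → Fin n → ℂ} :
    IsCaratheodorySolution A x ↔ IsPrimitive x (fun t => (A t).mulVec (x t)) := by
  refine ⟨fun h => ?_, fun h => ⟨h.absolutelyContinuousOnInterval, h.ae_hasDerivAt⟩⟩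
  -- Continuity of `x` is what makes `A x` locally integrable.
  have hc : Continuous x := continuous_iff_continuousAt.2 fun t => by
    refine (h.1 (t - 1) (t + 1)).continuousOn.continuousAt ?_
    rw [Set.uIcc_of_le (by linarith)]
    exact Icc_mem_nhds (by linarith) (by linarith)
  exact isPrimitive_of_absolutelyContinuous
    (fun a b => intervalIntegrable_mulVec (fun i j => hA i j a b) hc) h.1 h.2

theorem exists_isStateTransitionMatrix
    (hA : ∀ i j, ∀ a b : ℝ, IntervalIntegrable (fun t => A t i j) volume a b) :
    ∃ Φ, IsStateTransitionMatrix A Φ := by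
  choose u hu0 hu using fun i : Fin n => mulVecODE_exists hA (f := 0)
    (fun a b => IntervalIntegrable.zero) (Pi.single i 1)
  refine ⟨fun t => Matrix.of fun r i => u i t r, fun i => ⟨?_, hu0 i⟩⟩
  refine (isCaratheodorySolution_iff hA).2 ?_
  have := hu i
  simp only [Pi.zero_apply, add_zero] at this
  exact this

theorem IsStateTransitionMatrix.unique
    (hA : ∀ i j, ∀ a b : ℝ, IntervalIntegrable (fun t => A t i j) volume a b)
    {Ψ : ℝ → Matrix (Fin n) (Fin n) ℂ} (hΨ : IsStateTransitionMatrix A Ψ)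
    (hΦ : IsStateTransitionMatrix A Φ) : Ψ = Φ := by
  have h : ∀ i, (fun t => (Ψ t).col i) = fun t => (Φ t).col i := fun i =>
    mulVecODE_unique_homogeneous hA ((isCaratheodorySolution_iff hA).1 (hΨ i).1)
      ((isCaratheodorySolution_iff hA).1 (hΦ i).1) (by rw [(hΨ i).2, (hΦ i).2])
  funext t
  ext r i
  exact congrFun (congrFun (h i) t) r

theorem IsStateTransitionMatrix.zero (hΦ : IsStateTransitionMatrix A Φ) : Φ 0 = 1 := by
  ext r i
  have := congrFun (hΦ i).2 r
  rw [Matrix.col_apply] at this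
  rw [this, Matrix.one_apply, Pi.single_apply]

theorem isPrimitive_const_smul {E : Type*} [NormedAddCommGroup E] [NormedSpace ℝ E]
    [CompleteSpace E] {𝕜 : Type*} [RCLike 𝕜] [NormedSpace 𝕜 E] [IsScalarTower ℝ 𝕜 E]
    {F f : ℝ → E} (h : IsPrimitive F f) (c : 𝕜) :
    IsPrimitive (fun t => c • F t) (fun t => c • f t) := by
  have h1 : IsPrimitive (fun _ : ℝ => c) (fun _ => 0) :=
    ⟨fun a b => intervalIntegrable_const, fun t => by simp⟩
  simpa using h1.smul h

theorem IsStateTransitionMatrix.isPrimitive_mulVec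
    (hA : ∀ i j, ∀ a b : ℝ, IntervalIntegrable (fun t => A t i j) volume a b)
    (hΦ : IsStateTransitionMatrix A Φ) (v : Fin n → ℂ) :
    IsPrimitive (fun t => (Φ t).mulVec v) (fun t => (A t).mulVec ((Φ t).mulVec v)) := by
  have hs : ∀ t, (Φ t).mulVec v = ∑ i, v i • (Φ t).col i := fun t => by
    ext r
    simp [Matrix.mulVec, dotProduct, Finset.sum_apply, mul_comm]
  have h := IsPrimitive.sum Finset.univ fun i _ =>
    isPrimitive_const_smul ((isCaratheodorySolution_iff hA).1 (hΦ i).1) (v i)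
  simp only [hs, Matrix.mulVec_sum, Matrix.mulVec_smul]
  exact h

theorem IsStateTransitionMatrix.isPrimitive_exp_smul
    (hA : ∀ i j, ∀ a b : ℝ, IntervalIntegrable (fun t => A t i j) volume a b)
    (hΦ : IsStateTransitionMatrix A Φ) (z : ℂ) (v : Fin n → ℂ) :
    IsPrimitive (fun t : ℝ => exp (-z * t) • (Φ t).mulVec v)
      (fun t : ℝ => (A t - z • (1 : Matrix (Fin n) (Fin n) ℂ)).mulVec
        (exp (-z * t) • (Φ t).mulVec v)) := by
  have h := (isPrimitive_exp (-z)).smul (hΦ.isPrimitive_mulVec hA v)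
  have e : ∀ t : ℝ, (A t - z • (1 : Matrix (Fin n) (Fin n) ℂ)).mulVec
      (exp (-z * t) • (Φ t).mulVec v) = exp (-z * t) • (A t).mulVec ((Φ t).mulVec v)
        + (-z * exp (-z * t)) • (Φ t).mulVec v := fun t => by
    rw [Matrix.sub_mulVec, Matrix.mulVec_smul, Matrix.smul_mulVec, Matrix.one_mulVec, smul_smul,
      sub_eq_add_neg, ← neg_smul, neg_mul z (exp _)]
  simp only [e]
  exact h

theorem intervalIntegrable_sub_smul_one
    (hA : ∀ i j, ∀ a b : ℝ, IntervalIntegrable (fun t => A t i j) volume a b) (z : ℂ) :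
    ∀ i j, ∀ a b : ℝ, IntervalIntegrable
      (fun t => (A t - z • (1 : Matrix (Fin n) (Fin n) ℂ)) i j) volume a b := fun i j a b => by
  simp only [Matrix.sub_apply]
  exact (hA i j a b).sub intervalIntegrable_const

/-- By uniqueness `x t = e^{-zt} Φ(t) x(0)`; evaluate at `T`. -/
theorem IsStateTransitionMatrix.monodromy_eigenvector
    (hA : ∀ i j, ∀ a b : ℝ, IntervalIntegrable (fun t => A t i j) volume a b)
    (hΦ : IsStateTransitionMatrix A Φ) {T : ℝ} {z : ℂ} {x : ℝ → Fin n → ℂ}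
    (hx : IsPrimitive x
      (fun t => (A t - z • (1 : Matrix (Fin n) (Fin n) ℂ)).mulVec (x t))) (hT : x T = x 0) :
    (Φ T).mulVec (x 0) = exp (T * z) • x 0 := by
  have h := mulVecODE_unique_homogeneous (intervalIntegrable_sub_smul_one hA z) hx
    (hΦ.isPrimitive_exp_smul hA z (x 0)) (by simp [hΦ.zero])
  have h1 := congrFun h T
  rw [hT] at h1
  conv_rhs => rw [h1]
  rw [smul_smul, ← Complex.exp_add]
  simp [mul_comm]

/-- By periodicity of `A`, `t ↦ Φ(t + T) v` solves the same equation. It vanishes at `0`, hence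
everywhere, and its value at `-T` is `v`. So the eigenvalues of `Φ(T)` are nonzero and have
logarithms. -/
theorem IsStateTransitionMatrix.mulVec_injective
    (hA : ∀ i j, ∀ a b : ℝ, IntervalIntegrable (fun t => A t i j) volume a b)
    {T : ℝ} (hper : Function.Periodic A T)
    (hΦ : IsStateTransitionMatrix A Φ) {v : Fin n → ℂ} (hv : (Φ T).mulVec v = 0) : v = 0 := by
  have h := (hΦ.isPrimitive_mulVec hA v).comp_add_const T
  simp only [hper _] at h
  have h0 : IsPrimitive (0 : ℝ → Fin n → ℂ) (fun t => (A t).mulVec ((0 : ℝ → Fin n → ℂ) t)) :=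
    ⟨fun a b => by simp, fun t => by simp⟩
  have h1 := mulVecODE_unique_homogeneous hA h h0 (by simpa using hv)
  have h2 := congrFun h1 (-T)
  simpa [hΦ.zero] using h2

theorem IsStateTransitionMatrix.exists_periodic
    (hA : ∀ i j, ∀ a b : ℝ, IntervalIntegrable (fun t => A t i j) volume a b)
    (hΦ : IsStateTransitionMatrix A Φ) {T : ℝ} {z : ℂ}
    (hz : ¬ (Φ T).charpoly.IsRoot (exp (T * z)))
    {y : ℝ → Fin n → ℂ} (hy : ∀ a b : ℝ, IntervalIntegrable y volume a b) :
    ∃ x : ℝ → Fin n → ℂ, IsPrimitive x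
      (fun t => (A t - z • (1 : Matrix (Fin n) (Fin n) ℂ)).mulVec (x t) + y t) ∧ x T = x 0 := by
  obtain ⟨u, hu0, hu⟩ := mulVecODE_exists (intervalIntegrable_sub_smul_one hA z) hy 0
  rw [Polynomial.IsRoot, Matrix.eval_charpoly] at hz
  set M := Matrix.scalar (Fin n) (exp (T * z)) - Φ T with hM
  -- Adding `e^{-zt} Φ(t) v` to the solution `u` with `u 0 = 0` gives a periodic function iff `u(T)
  -- + e^{-zT} Φ(T) v = v`, that is, `(e^{zT} - Φ(T)) v = e^{zT} u(T)`.
  set v := M⁻¹.mulVec (exp (T * z) • u T) with hv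
  have hMv : M.mulVec v = exp (T * z) • u T := by
    rw [hv, Matrix.mulVec_mulVec, Matrix.mul_nonsing_inv _ (isUnit_iff_ne_zero.2 hz),
      Matrix.one_mulVec]
  refine ⟨fun t => u t + exp (-z * t) • (Φ t).mulVec v, ?_, ?_⟩
  · have h := hu.add (hΦ.isPrimitive_exp_smul hA z v)
    simp only [Matrix.mulVec_add]
    convert h using 2
    abel
  · have h1 : exp (T * z) • v - (Φ T).mulVec v = exp (T * z) • u T := by
      rw [← hMv, hM, Matrix.sub_mulVec]
      congr 1
      ext i
      simp [Matrix.scalar_apply, Matrix.mulVec_diagonal]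
    have h2 : exp (-z * T) * exp (T * z) = 1 := by
      rw [← Complex.exp_add, show -z * (T : ℂ) + T * z = 0 by ring, exp_zero]
    have h3 : (Φ T).mulVec v = exp (T * z) • v - exp (T * z) • u T := by rw [← h1]; abel
    simp only [hu0, h3, hΦ.zero, smul_sub, smul_smul, h2, one_smul]
    simp

theorem isRoot_charpoly_iff (P : Matrix (Fin n) (Fin n) ℂ) (c : ℂ) :
    P.charpoly.IsRoot c ↔ ∃ v, v ≠ 0 ∧ P.mulVec v = c • v := by
  rw [Polynomial.IsRoot, Matrix.eval_charpoly, ← Matrix.exists_mulVec_eq_zero_iff]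
  refine exists_congr fun v => and_congr_right fun _ => ?_
  rw [Matrix.sub_mulVec, sub_eq_zero, eq_comm]
  have : (Matrix.scalar (Fin n) c).mulVec v = c • v := by
    ext i
    simp [Matrix.scalar_apply, Matrix.mulVec_diagonal]
  rw [this]

theorem exists_isFloquetExponents {T : ℝ} (hT : T ≠ 0) {P : Matrix (Fin n) (Fin n) ℂ}
    (hP : ∀ v, P.mulVec v = 0 → v = 0) : ∃ lam, IsFloquetExponents T P lam := by
  have hcard : P.charpoly.roots.card = n := by
    rw [← (IsAlgClosed.splits P.charpoly).natDegree_eq_card_roots, Matrix.charpoly_natDegree_eq_dim,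
      Fintype.card_fin]
  obtain ⟨l, hl⟩ := Quot.exists_rep P.charpoly.roots
  have hl' : (l : Multiset ℂ) = P.charpoly.roots := hl
  have hlen : l.length = n := by rw [← Multiset.coe_card, hl', hcard]
  subst hlen
  have hne : ∀ p, l.get p ≠ 0 := fun p h0 => by
    have hm : l.get p ∈ P.charpoly.roots := by
      rw [← hl', Multiset.mem_coe]
      exact List.get_mem _ _
    rw [h0] at hm
    obtain ⟨v, hv, hv'⟩ := (isRoot_charpoly_iff P 0).1 (Polynomial.isRoot_of_mem_roots hm)
    exact hv (hP v (by simpa using hv'))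
  refine ⟨fun p => Complex.log (l.get p) / T, ?_⟩
  have hTc : (T : ℂ) ≠ 0 := by exact_mod_cast hT
  rw [IsFloquetExponents, ← hl']
  have : (fun p : Fin l.length => exp (T * (Complex.log (l.get p) / T))) = l.get := by
    funext p
    rw [mul_div_cancel₀ _ hTc, Complex.exp_log (hne p)]
  rw [this, Fin.univ_val_map, List.ofFn_get]

end StateTransition

/-! ### The harmonic operator and periodic solutions -/

section HarmonicOperator

/-- Since `W` is already in `ℓ²`, domain membership and value reduce to one scalar series per row.
-/
theorem matrixOperator_apply_iff {ι : Type*} (M : Matrix ι ι ℂ) (X W : EllTwo ι) :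
    (∃ h : X ∈ (matrixOperator M).domain, matrixOperator M ⟨X, h⟩ = W) ↔
      ∀ r, HasSum (fun s => M r s * X s) (W r) := by
  constructor
  · rintro ⟨h, rfl⟩ r
    exact (h.1 r).hasSum
  · intro h
    have e : (fun r => ∑' s, M r s * X s) = W := funext fun r => (h r).tsum_eq
    have hX : X ∈ (matrixOperator M).domain := ⟨fun r => (h r).summable, e ▸ lp.memℓp W⟩
    exact ⟨hX, lp.ext e⟩

theorem hasSum_prod_of_fintype {ι κ α : Type*} [Fintype ι] [AddCommMonoid α]
    [TopologicalSpace α] [ContinuousAdd α] {f : ι × κ → α} {g : ι → α}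
    (h : ∀ i, HasSum (fun k => f (i, k)) (g i)) : HasSum f (∑ i, g i) := by
  classical
  have hf : f = fun s => ∑ i, if s.1 = i then f s else 0 := by
    funext s
    simp
  rw [hf]
  refine hasSum_sum fun i _ => ?_
  have hi : Function.Injective (Prod.mk i : κ → ι × κ) := Prod.mk_right_injective i
  rw [← hi.hasSum_iff]
  · simpa [Function.comp_def] using h i
  · rintro ⟨j, k⟩ hjk
    refine if_neg fun hj => hjk ⟨k, ?_⟩
    exact Prod.ext (Eq.symm hj) rfl

theorem memℓp_two_iff {ι : Type*} {f : ι → ℂ} : Memℓp f 2 ↔ Summable fun i => ‖f i‖ ^ 2 := by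
  rw [memℓp_gen_iff (by norm_num)]
  norm_num

theorem memℓp_prod_of_fintype {ι κ : Type*} [Fintype ι] {f : ι × κ → ℂ}
    (h : ∀ i, Memℓp (fun k => f (i, k)) 2) : Memℓp f 2 :=
  memℓp_two_iff.2 (hasSum_prod_of_fintype fun i => (memℓp_two_iff.1 (h i)).hasSum).summable

theorem exists_ellTwo_eq {ι κ : Type*} [Fintype ι] {F : ι → κ → ℂ} (h : ∀ i, Memℓp (F i) 2) :
    ∃ X : EllTwo (ι × κ), ∀ i k, F i k = X (i, k) :=
  ⟨⟨fun s => F s.1 s.2, memℓp_prod_of_fintype h⟩, fun _ _ => rfl⟩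

theorem Memℓp.comp_injective_two {ι κ : Type*} {f : ι → ℂ} (h : Memℓp f 2) {φ : κ → ι}
    (hφ : Function.Injective φ) : Memℓp (fun k => f (φ k)) 2 :=
  memℓp_two_iff.2 ((memℓp_two_iff.1 h).comp_injective hφ)

variable {n : ℕ} {T : ℝ} {A Φ : ℝ → Matrix (Fin n) (Fin n) ℂ}

/-- A row of `𝒩` has at most one nonzero entry, so the row series of `𝒜` and of `𝒜 - 𝒩` converge
together. -/
theorem hasSum_harmonic_iff (X : Fin n × ℤ → ℂ) (i : Fin n) (k : ℤ) (c : ℂ) :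
    HasSum (fun s => (blockToeplitz T A - harmonicDiag n T) (i, k) s * X s)
        (c - I * angularFreq T * k * X (i, k)) ↔
      HasSum (fun s => blockToeplitz T A (i, k) s * X s) c := by
  have h : HasSum (fun s => harmonicDiag n T (i, k) s * X s)
      (I * angularFreq T * k * X (i, k)) := by
    convert hasSum_single (i, k) (fun s hs => ?_) using 1
    · simp [harmonicDiag]
    · obtain ⟨j, m⟩ := s
      rw [harmonicDiag, Matrix.kronecker_apply]
      by_cases hj : i = j
      · subst hj
        have hm : k ≠ m := fun e => hs (by rw [e])
        simp [Matrix.diagonal_apply_ne _ hm]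
      · simp [Matrix.one_apply_ne hj]
  simp only [Matrix.sub_apply, sub_mul]
  refine ⟨fun h' => ?_, fun h' => h'.sub h⟩
  simpa using h'.add h

theorem hasSum_blockToeplitz (hT : 0 < T)
    (hA : ∀ i j, MemLp (fun t => A t i j) 2 (volume.restrict (Set.Ioc 0 T)))
    {x : ℝ → Fin n → ℂ} (hx : ∀ l, MemLp (fun t => x t l) 2 (volume.restrict (Set.Ioc 0 T)))
    {X : Fin n × ℤ → ℂ} (hX : ∀ l m, phasor T (fun t => x t l) m = X (l, m))
    (i : Fin n) (k : ℤ) :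
    HasSum (fun s => blockToeplitz T A (i, k) s * X s)
      (phasor T (fun t => (A t).mulVec (x t) i) k) := by
  have h := hasSum_prod_of_fintype (f := fun s => blockToeplitz T A (i, k) s * X s)
    (g := fun l => phasor T (fun t => A t i l * x t l) k) fun l => by
      simp only [← hX]
      exact hasSum_phasor_mul hT (hA i l) (hx l) k
  rw [← phasor_sum] at h
  · exact h
  · exact fun l _ => (intervalIntegrable_iff_integrableOn_Ioc_of_le hT.le).2
      ((hA i l).integrable_mul (hx l))

theorem memℓp_blockToeplitz_row (hT : 0 < T)
    (hA : ∀ i j, MemLp (fun t => A t i j) 2 (volume.restrict (Set.Ioc 0 T))) (r : Fin n × ℤ) :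
    Memℓp (fun s => blockToeplitz T A r s) 2 :=
  memℓp_prod_of_fintype fun l =>
    (memℓp_phasor hT (hA r.1 l)).comp_injective_two (φ := fun m => r.2 - m) sub_right_injective

theorem harmonicOperator_apply_iff (hT : 0 < T)
    (hA : ∀ i j, MemLp (fun t => A t i j) 2 (volume.restrict (Set.Ioc 0 T)))
    {x : ℝ → Fin n → ℂ} (hx : ∀ l, MemLp (fun t => x t l) 2 (volume.restrict (Set.Ioc 0 T)))
    {X W : EllTwo (Fin n × ℤ)} (hX : ∀ l m, phasor T (fun t => x t l) m = X (l, m)) :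
    (∃ h : X ∈ (harmonicOperator T A).domain, harmonicOperator T A ⟨X, h⟩ = W) ↔
      ∀ i k, phasor T (fun t => (A t).mulVec (x t) i) k - I * angularFreq T * k * X (i, k)
        = W (i, k) := by
  rw [harmonicOperator, matrixOperator_apply_iff, Prod.forall]
  refine forall₂_congr fun i k => ?_
  have h := (hasSum_harmonic_iff X i k _).2 (hasSum_blockToeplitz hT hA hx hX i k)
  exact ⟨fun h' => h.unique h', fun h' => h' ▸ h⟩

/-- The harmonic operator has a closed graph. -/
theorem harmonicOperator_closed (hT : 0 < T)
    (hA : ∀ i j, MemLp (fun t => A t i j) 2 (volume.restrict (Set.Ioc 0 T)))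
    {X W : ℕ → EllTwo (Fin n × ℤ)} {X₀ W₀ : EllTwo (Fin n × ℤ)}
    (h : ∀ j, ∃ h : X j ∈ (harmonicOperator T A).domain, harmonicOperator T A ⟨X j, h⟩ = W j)
    (hX : Tendsto X atTop (𝓝 X₀)) (hW : Tendsto W atTop (𝓝 W₀)) :
    ∃ h : X₀ ∈ (harmonicOperator T A).domain, harmonicOperator T A ⟨X₀, h⟩ = W₀ := by
  simp only [harmonicOperator, matrixOperator_apply_iff, Prod.forall] at h ⊢
  intro i k
  -- The row series of `𝒜` is the inner product with the conjugated row `ρ ∈ ℓ²`. It converges for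
  -- every `Y ∈ ℓ²` and is continuous in `Y`, so each row equation passes to the limit.
  let ρ : EllTwo (Fin n × ℤ) := ⟨fun s => star (blockToeplitz T A (i, k) s),
    memℓp_two_iff.2 (by simpa using memℓp_two_iff.1 (memℓp_blockToeplitz_row hT hA (i, k)))⟩
  have hsum : ∀ Y : EllTwo (Fin n × ℤ), HasSum
      (fun s => (blockToeplitz T A - harmonicDiag n T) (i, k) s * Y s)
      (inner ℂ ρ Y - I * angularFreq T * k * Y (i, k)) := fun Y => by
    refine (hasSum_harmonic_iff (Y : Fin n × ℤ → ℂ) i k _).2 ?_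
    have := lp.hasSum_inner (𝕜 := ℂ) ρ Y
    refine this.congr_fun fun s => ?_
    simp [ρ, mul_comm]
  have hev : ∀ r, Continuous fun Y : EllTwo (Fin n × ℤ) => Y r := fun r =>
    (lp.evalCLM ℂ (fun _ : Fin n × ℤ => ℂ) 2 r).continuous
  have h1 : Tendsto (fun j => W j (i, k)) atTop
      (𝓝 (inner ℂ ρ X₀ - I * angularFreq T * k * X₀ (i, k))) := by
    have h2 : ∀ j, W j (i, k) = inner ℂ ρ (X j) - I * angularFreq T * k * X j (i, k) := fun j =>
      (h j i k).unique (hsum (X j))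
    simp only [h2]
    have hc : Continuous fun Y : EllTwo (Fin n × ℤ) =>
        inner ℂ ρ Y - I * angularFreq T * k * Y (i, k) :=
      (continuous_const.inner continuous_id).sub (continuous_const.mul (hev _))
    exact (hc.tendsto X₀).comp hX
  rw [tendsto_nhds_unique (((hev (i, k)).tendsto W₀).comp hW) h1]
  exact hsum X₀

theorem exists_phasor_eq_vector (hT : 0 < T) (X : EllTwo (Fin n × ℤ)) :
    ∃ x : ℝ → Fin n → ℂ, Function.Periodic x T ∧
      (∀ l, MemLp (fun t => x t l) 2 (volume.restrict (Set.Ioc 0 T))) ∧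
      ∀ l m, phasor T (fun t => x t l) m = X (l, m) := by
  choose x h1 h2 h3 using fun l : Fin n => exists_phasor_eq hT
    ((lp.memℓp X).comp_injective_two (φ := fun m : ℤ => (l, m)) (Prod.mk_right_injective l))
  exact ⟨fun t l => x l t, fun t => funext fun l => h1 l t, h2, h3⟩

theorem intervalIntegrable_of_periodic_memLp (hT : 0 < T) {f : ℝ → ℂ}
    (hp : Function.Periodic f T) (hf : MemLp f 2 (volume.restrict (Set.Ioc 0 T))) (a b : ℝ) :
    IntervalIntegrable f volume a b :=
  hp.intervalIntegrable₀ hT.ne' (intervalIntegrable_of_memLp hT hf) a b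

/-- A solution `X ∈ ℓ²` of `z X - (𝒜 - 𝒩) X = Y` consists of the phasors of a `T`-periodic
solution of `x' = (A(t) - z) x + y`. -/
theorem exists_periodic_of_harmonicOperator (hT : 0 < T) (hper : Function.Periodic A T)
    (hA : ∀ i j, MemLp (fun t => A t i j) 2 (volume.restrict (Set.Ioc 0 T))) {z : ℂ}
    {X Y : EllTwo (Fin n × ℤ)}
    (hX : ∃ h : X ∈ (harmonicOperator T A).domain, harmonicOperator T A ⟨X, h⟩ = z • X - Y)
    {y : ℝ → Fin n → ℂ} (hyp : Function.Periodic y T)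
    (hy : ∀ l, MemLp (fun t => y t l) 2 (volume.restrict (Set.Ioc 0 T)))
    (hY : ∀ l m, phasor T (fun t => y t l) m = Y (l, m)) :
    ∃ x : ℝ → Fin n → ℂ, IsPrimitive x
      (fun t => (A t - z • (1 : Matrix (Fin n) (Fin n) ℂ)).mulVec (x t) + y t) ∧ x T = x 0 ∧
      ∀ l m, phasor T (fun t => x t l) m = X (l, m) := by
  obtain ⟨x, hxp, hxm, hxX⟩ := exists_phasor_eq_vector hT X
  set f : ℝ → Fin n → ℂ := fun t =>
    (A t - z • (1 : Matrix (Fin n) (Fin n) ℂ)).mulVec (x t) + y t with hf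
  have hfi : ∀ t i, f t i = (A t).mulVec (x t) i - z * x t i + y t i := fun t i => by
    simp [hf, Matrix.sub_mulVec, Matrix.smul_mulVec]
  have hAx : ∀ i, IntervalIntegrable (fun t => (A t).mulVec (x t) i) volume 0 T := fun i => by
    refine (IntervalIntegrable.sum (f := fun l t => A t i l * x t l) Finset.univ fun l _ =>
      (intervalIntegrable_iff_integrableOn_Ioc_of_le hT.le).2
        ((hA i l).integrable_mul (hxm l))).congr_ae (Eventually.of_forall fun t => ?_)
    simp [Matrix.mulVec, dotProduct]
  have hzx : ∀ i, IntervalIntegrable (fun t => z * x t i) volume 0 T := fun i =>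
    (intervalIntegrable_of_memLp hT (hxm i)).const_mul z
  have hyi := fun i => intervalIntegrable_of_memLp hT (hy i)
  have hfper : Function.Periodic f T := fun t => by simp only [hf, hper t, hxp t, hyp t]
  have hfint : ∀ i, ∀ a b : ℝ, IntervalIntegrable (fun t => f t i) volume a b := fun i => by
    refine Function.Periodic.intervalIntegrable₀ (fun t => by simp only [hfper t]) hT.ne' ?_
    simp only [hfi]
    exact ((hAx i).sub (hzx i)).add (hyi i)
  have hph : ∀ i k, phasor T (fun t => f t i) k
      = I * angularFreq T * k * phasor T (fun t => x t i) k := fun i k => by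
    have h := (harmonicOperator_apply_iff hT hA hxm hxX).1 hX i k
    have h2 : (z • X - Y) (i, k) = z * X (i, k) - Y (i, k) := rfl
    simp only [hfi]
    rw [phasor_add ((hAx i).sub (hzx i)) (hyi i), phasor_sub (hAx i) (hzx i), phasor_const_mul,
      hY, hxX]
    rw [h2] at h
    linear_combination h
  -- `w` is the absolutely continuous representative of `x`. It is periodic because `f` is, so `x =
  -- w` almost everywhere on `ℝ` and `x` can be replaced by `w` inside `f`.
  choose w hw hwT hxw using fun i =>
    exists_isPrimitive_of_phasor_eq hT (hxm i) (hfint i) (hph i)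
  have hwper : ∀ i, Function.Periodic (w i) T := fun i t => by
    have h1 := (hw i).sub_eq t (t + T)
    rw [Function.Periodic.intervalIntegral_add_eq (f := fun t => f t i)
      (fun t => by simp only [hfper t]) t 0, zero_add, ← (hw i).sub_eq, hwT, sub_self] at h1
    exact sub_eq_zero.1 h1
  have hae : ∀ᵐ t, ∀ i, x t i = w i t := ae_all_iff.2 fun i =>
    ae_of_periodic hT (fun t => by simp only [hxp t, hwper i t]) (hxw i)
  refine ⟨fun t i => w i t, ?_, funext hwT, fun l m => ?_⟩
  · refine (IsPrimitive.pi hw : IsPrimitive _ f).congr ?_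
    filter_upwards [hae] with t ht
    have : x t = fun i => w i t := funext ht
    simp only [hf, this]
  · rw [← hxX]
    exact phasor_congr hT ((hxw l).mono fun t ht => ht.symm) m

/-- The phasors of a `T`-periodic solution of `x' = (A(t) - z) x + y` solve
`z X - (𝒜 - 𝒩) X = Y`. -/
theorem harmonicOperator_of_periodic (hT : 0 < T)
    (hA : ∀ i j, MemLp (fun t => A t i j) 2 (volume.restrict (Set.Ioc 0 T)))
    (hAint : ∀ i j, ∀ a b : ℝ, IntervalIntegrable (fun t => A t i j) volume a b) {z : ℂ}
    {Y : EllTwo (Fin n × ℤ)} {x y : ℝ → Fin n → ℂ}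
    (hy : ∀ l, MemLp (fun t => y t l) 2 (volume.restrict (Set.Ioc 0 T)))
    (hY : ∀ l m, phasor T (fun t => y t l) m = Y (l, m))
    (hx : IsPrimitive x
      (fun t => (A t - z • (1 : Matrix (Fin n) (Fin n) ℂ)).mulVec (x t) + y t))
    (hxT : x T = x 0) :
    ∃ X : EllTwo (Fin n × ℤ), (∀ l m, phasor T (fun t => x t l) m = X (l, m)) ∧
      ∃ h : X ∈ (harmonicOperator T A).domain, harmonicOperator T A ⟨X, h⟩ = z • X - Y := by
  have hxc : ∀ l, Continuous fun t => x t l := fun l => (continuous_apply l).comp hx.continuous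
  have hxm : ∀ l, MemLp (fun t => x t l) 2 (volume.restrict (Set.Ioc 0 T)) := fun l =>
    memLp_of_continuous (hxc l)
  obtain ⟨X, hX⟩ := exists_ellTwo_eq fun l => memℓp_phasor hT (hxm l)
  refine ⟨X, hX, (harmonicOperator_apply_iff hT hA hxm hX).2 fun i k => ?_⟩
  have h2 : (z • X - Y) (i, k) = z * X (i, k) - Y (i, k) := rfl
  have h := phasor_of_isPrimitive hT (hx.eval i) (congrFun hxT i) k
  have hfi : ∀ t, ((A t - z • (1 : Matrix (Fin n) (Fin n) ℂ)).mulVec (x t) + y t) i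
      = (A t).mulVec (x t) i - z * x t i + y t i := fun t => by
    simp [Matrix.sub_mulVec, Matrix.smul_mulVec]
  have hAx : IntervalIntegrable (fun t => (A t).mulVec (x t) i) volume 0 T := by
    have := intervalIntegrable_mulVec (fun i j => hAint i j 0 T) hx.continuous
    exact ⟨Integrable.eval this.1 i, Integrable.eval this.2 i⟩
  have hzx : IntervalIntegrable (fun t => z * x t i) volume 0 T :=
    ((hxc i).intervalIntegrable 0 T).const_mul z
  simp only [hfi] at h
  rw [phasor_add (hAx.sub hzx) (intervalIntegrable_of_memLp hT (hy i)), phasor_sub hAx hzx,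
    phasor_const_mul, hY, hX] at h
  rw [h2]
  linear_combination h

end HarmonicOperator

/-! ### Spectrum and point spectrum -/

section Spectrum

variable {n : ℕ} {T : ℝ} {A Φ : ℝ → Matrix (Fin n) (Fin n) ℂ}

theorem operatorPointSpectrum_subset {E : Type*} [NormedAddCommGroup E] [NormedSpace ℂ E]
    (L : E →ₗ.[ℂ] E) : operatorPointSpectrum L ⊆ operatorSpectrum L := by
  rintro z ⟨x, hx, hLx⟩ ⟨R, -, hR⟩
  have h := hR x
  rw [hLx, sub_self, map_zero] at h
  exact hx (Subtype.ext h.symm)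

theorem isRoot_charpoly_of_harmonicOperator_apply_eq (hT : 0 < T) (hper : Function.Periodic A T)
    (hA : ∀ i j, MemLp (fun t => A t i j) 2 (volume.restrict (Set.Ioc 0 T)))
    (hAint : ∀ i j, ∀ a b : ℝ, IntervalIntegrable (fun t => A t i j) volume a b)
    (hΦ : IsStateTransitionMatrix A Φ) {z : ℂ} {X : EllTwo (Fin n × ℤ)} (hX0 : X ≠ 0)
    (hX : ∃ h : X ∈ (harmonicOperator T A).domain, harmonicOperator T A ⟨X, h⟩ = z • X) :
    (Φ T).charpoly.IsRoot (exp (T * z)) := by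
  obtain ⟨x, hx, hxT, hxX⟩ := exists_periodic_of_harmonicOperator hT hper hA (Y := 0)
    (by simpa using hX) (y := 0) (fun t => rfl) (fun l => MemLp.zero)
    (fun l m => by simp [phasor])
  simp only [Pi.zero_apply, add_zero] at hx
  refine (isRoot_charpoly_iff _ _).2 ⟨x 0, fun h0 => hX0 ?_, hΦ.monodromy_eigenvector hAint hx hxT⟩
  have hx0 : x = fun _ => 0 := mulVecODE_unique_homogeneous (intervalIntegrable_sub_smul_one hAint z)
    hx ⟨fun a b => by simp, fun t => by simp⟩ h0
  ext ⟨l, m⟩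
  rw [← hxX, hx0]
  simp [phasor]

theorem mem_operatorPointSpectrum_harmonicOperator (hT : 0 < T)
    (hper : Function.Periodic A T)
    (hA : ∀ i j, MemLp (fun t => A t i j) 2 (volume.restrict (Set.Ioc 0 T)))
    (hAint : ∀ i j, ∀ a b : ℝ, IntervalIntegrable (fun t => A t i j) volume a b)
    (hΦ : IsStateTransitionMatrix A Φ) {z : ℂ} :
    z ∈ operatorPointSpectrum (harmonicOperator T A) ↔
      (Φ T).charpoly.IsRoot (exp (T * z)) := by
  constructor
  · rintro ⟨X, hX0, hX⟩
    exact isRoot_charpoly_of_harmonicOperator_apply_eq hT hper hA hAint hΦ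
      (fun h => hX0 (Subtype.ext h)) ⟨X.2, hX⟩
  · intro hz
    obtain ⟨v, hv0, hv⟩ := (isRoot_charpoly_iff _ _).1 hz
    have hx := hΦ.isPrimitive_exp_smul hAint z v
    have hxT : exp (-z * T) • (Φ T).mulVec v = exp (-z * (0 : ℝ)) • (Φ 0).mulVec v := by
      rw [hv, smul_smul, ← Complex.exp_add, hΦ.zero, show -z * (T : ℂ) + T * z = 0 by ring]
      simp
    obtain ⟨X, hxX, h, hX⟩ := harmonicOperator_of_periodic hT hA hAint (Y := 0) (y := 0)
      (x := fun t : ℝ => exp (-z * t) • (Φ t).mulVec v) (z := z)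
      (fun l => MemLp.zero) (fun l m => by simp [phasor])
      (by simpa only [Pi.zero_apply, add_zero] using hx) hxT
    refine ⟨⟨X, h⟩, fun h0 => hv0 ?_, by simpa using hX⟩
    have hX0 : X = 0 := congrArg Subtype.val h0
    have hc : ∀ l, Continuous fun t : ℝ => (exp (-z * t) • (Φ t).mulVec v) l := fun l =>
      (continuous_apply l).comp hx.continuous
    -- If all phasors vanish, the solution is zero almost everywhere on a period, hence everywhere
    -- on `[0, T]` by continuity. Its value at `0` is `v`.
    have hz : ∀ l, ∀ t ∈ Set.Icc 0 T, (exp (-z * t) • (Φ t).mulVec v) l = 0 := fun l t ht => by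
      have h1 := ae_eq_zero_of_phasor_eq_zero hT (memLp_of_continuous (hc l))
        (fun m => by rw [hxX, hX0]; rfl)
      have h2 := Measure.eqOn_Icc_of_ae_eq (μ := volume) hT.ne
        (by rw [← restrict_Ioc_eq_restrict_Icc]; exact h1) (hc l).continuousOn continuousOn_const
      exact h2 ht
    ext l
    simpa [hΦ.zero] using hz l 0 ⟨le_rfl, hT.le⟩

/-- Injectivity comes from the absence of eigenvectors, surjectivity from the periodic response to
each forcing, and boundedness of the inverse from closedness of the operator. -/
theorem mem_operatorResolventSet_harmonicOperator (hT : 0 < T)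
    (hper : Function.Periodic A T)
    (hA : ∀ i j, MemLp (fun t => A t i j) 2 (volume.restrict (Set.Ioc 0 T)))
    (hAint : ∀ i j, ∀ a b : ℝ, IntervalIntegrable (fun t => A t i j) volume a b)
    (hΦ : IsStateTransitionMatrix A Φ) {z : ℂ}
    (hz : ¬ (Φ T).charpoly.IsRoot (exp (T * z))) :
    z ∈ operatorResolventSet (harmonicOperator T A) := by
  set L := harmonicOperator T A
  let S : L.domain →ₗ[ℂ] EllTwo (Fin n × ℤ) := z • L.domain.subtype - L.toFun
  have hS : ∀ X, S X = z • (X : EllTwo (Fin n × ℤ)) - L X := fun X => rfl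
  have hinj : Function.Injective S := by
    refine (injective_iff_map_eq_zero S).2 fun X hX => ?_
    by_contra hX0
    rw [hS, sub_eq_zero] at hX
    exact hz (isRoot_charpoly_of_harmonicOperator_apply_eq hT hper hA hAint hΦ
      (fun h => hX0 (Subtype.ext h)) ⟨X.2, hX.symm⟩)
  have hsurj : Function.Surjective S := fun Y => by
    obtain ⟨y, hyp, hym, hyY⟩ := exists_phasor_eq_vector hT Y
    have hyi : ∀ a b : ℝ, IntervalIntegrable y volume a b := fun a b =>
      have h := fun l => intervalIntegrable_of_periodic_memLp hT
        (f := fun t => y t l) (fun t => by simp only [hyp t]) (hym l) a b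
      ⟨Integrable.of_eval fun l => (h l).1, Integrable.of_eval fun l => (h l).2⟩
    obtain ⟨x, hx, hxT⟩ := hΦ.exists_periodic hAint hz hyi
    obtain ⟨X, -, h, hX⟩ := harmonicOperator_of_periodic hT hA hAint hym hyY hx hxT
    exact ⟨⟨X, h⟩, by rw [hS, hX, sub_sub_cancel]⟩
  let e := LinearEquiv.ofBijective S ⟨hinj, hsurj⟩
  let R : EllTwo (Fin n × ℤ) →ₗ[ℂ] EllTwo (Fin n × ℤ) := L.domain.subtype ∘ₗ e.symm.toLinearMap
  have hRS : ∀ X : L.domain, R (S X) = X := fun X =>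
    congrArg Subtype.val (e.symm_apply_apply X)
  have hSR : ∀ Y, S (e.symm Y) = Y := e.apply_symm_apply
  have hLR : ∀ Y, L (e.symm Y) = z • R Y - Y := fun Y =>
    eq_sub_of_add_eq' (sub_eq_iff_eq_add.1 (hSR Y)).symm
  have hRc : Continuous R := by
    refine LinearMap.continuous_of_seq_closed_graph R fun u X Y hu hRu => ?_
    obtain ⟨h, hLY⟩ := harmonicOperator_closed hT hA (X := fun j => R (u j))
      (W := fun j => z • R (u j) - u j) (X₀ := Y) (W₀ := z • Y - X)
      (fun j => ⟨(e.symm (u j)).2, hLR (u j)⟩) hRu ((hRu.const_smul z).sub hu)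
    have h1 : S ⟨Y, h⟩ = X := by rw [hS, hLY, sub_sub_cancel]
    rw [← h1, hRS]
  exact ⟨⟨R, hRc⟩, fun Y => ⟨(e.symm Y).2, hSR Y⟩, hRS⟩

/-- `e^{Tz} = e^{Tλ}` iff `z - λ` is an integer multiple of `2πj/T = jω`, whichever logarithm `λ`
is. -/
theorem isRoot_charpoly_iff_exists (hT : 0 < T) {P : Matrix (Fin n) (Fin n) ℂ} {lam : Fin n → ℂ}
    (hlam : IsFloquetExponents T P lam) (z : ℂ) :
    P.charpoly.IsRoot (exp (T * z)) ↔
      ∃ (p : Fin n) (k : ℤ), z = lam p + I * angularFreq T * k := by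
  have hTc : (T : ℂ) ≠ 0 := by exact_mod_cast hT.ne'
  rw [← Polynomial.mem_roots P.charpoly_monic.ne_zero, ← hlam, Multiset.mem_map]
  simp only [Finset.mem_val, Finset.mem_univ, true_and]
  refine exists_congr fun p => ?_
  rw [eq_comm, Complex.exp_eq_exp_iff_exists_int]
  refine exists_congr fun k => ?_
  simp only [angularFreq]
  push_cast
  constructor
  · intro h
    field_simp
    linear_combination h
  · rintro rfl
    field_simp

theorem not_isBounded_floquet_lattice (hT : 0 < T) (c : ℂ) {s : Set ℂ}
    (hs : ∀ k : ℤ, c + I * angularFreq T * k ∈ s) : ¬ Bornology.IsBounded s := by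
  intro hb
  obtain ⟨C, hC⟩ := hb.exists_norm_le
  have hω : 0 < angularFreq T := div_pos (mul_pos two_pos Real.pi_pos) hT
  obtain ⟨N, hN⟩ := exists_nat_gt ((C + ‖c‖) / angularFreq T)
  have h1 := hC _ (hs N)
  have h2 : ‖I * angularFreq T * ((N : ℤ) : ℂ)‖ = angularFreq T * N := by
    simp [abs_of_pos hω]
  have h3 := norm_sub_le (c + I * angularFreq T * ((N : ℤ) : ℂ)) c
  rw [add_sub_cancel_left, h2] at h3
  rw [div_lt_iff₀ hω] at hN
  linarith

/-- The derivative of `w ↦ e^{Tw}` never vanishes, so on a punctured neighbourhood of `z` it avoids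
each of the finitely many roots. -/
theorem not_accPt_of_exp_isRoot (hT : 0 < T) {p : Polynomial ℂ} (hp : p ≠ 0) (z : ℂ) :
    ¬ AccPt z (𝓟 {w | p.IsRoot (exp (T * w))}) := by
  have hTc : (T : ℂ) ≠ 0 := by exact_mod_cast hT.ne'
  rw [accPt_iff_frequently_nhdsNE, not_frequently]
  have hd : HasDerivAt (fun w : ℂ => exp (T * w)) (exp (T * z) * T) z := by
    simpa using ((hasDerivAt_id z).const_mul (T : ℂ)).cexp
  have h : ∀ c ∈ p.roots.toFinset, ∀ᶠ w in 𝓝[≠] z, exp (T * w) ≠ c := fun c _ =>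
    hd.eventually_ne (mul_ne_zero (exp_ne_zero _) hTc)
  filter_upwards [(Finset.eventually_all p.roots.toFinset).2 h] with w hw hroot
  exact hw _ (by simpa [hp] using hroot) rfl

end Spectrum

theorem mainTheorem6 (n : ℕ) (hn : 0 < n) (T : ℝ) (hT : 0 < T)
    (A : ℝ → Matrix (Fin n) (Fin n) ℂ) (hper : Function.Periodic A T)
    (hA : ∀ i j, MemLp (fun t => A t i j) 2 (volume.restrict (Set.Ioc 0 T))) :
    ∃ Φ : ℝ → Matrix (Fin n) (Fin n) ℂ,
      IsStateTransitionMatrix A Φ ∧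
      (∀ Ψ, IsStateTransitionMatrix A Ψ → Ψ = Φ) ∧
      (∃ lam : Fin n → ℂ, IsFloquetExponents T (Φ T) lam) ∧
      (∀ lam : Fin n → ℂ, IsFloquetExponents T (Φ T) lam →
        operatorSpectrum (harmonicOperator T A) =
            {z | ∃ (p : Fin n) (k : ℤ), z = lam p + I * angularFreq T * k} ∧
        operatorPointSpectrum (harmonicOperator T A) =
            {z | ∃ (p : Fin n) (k : ℤ), z = lam p + I * angularFreq T * k}) ∧
      ¬ Bornology.IsBounded (operatorSpectrum (harmonicOperator T A)) ∧
      (∀ z : ℂ, ¬ AccPt z (𝓟 (operatorSpectrum (harmonicOperator T A)))) := by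
  have hAint : ∀ i j, ∀ a b : ℝ, IntervalIntegrable (fun t => A t i j) volume a b :=
    fun i j => intervalIntegrable_of_periodic_memLp hT (fun t => by simp only [hper t]) (hA i j)
  obtain ⟨Φ, hΦ⟩ := exists_isStateTransitionMatrix hAint
  have hpoint : operatorPointSpectrum (harmonicOperator T A)
      = {z | (Φ T).charpoly.IsRoot (exp (T * z))} :=
    Set.ext fun z => mem_operatorPointSpectrum_harmonicOperator hT hper hA hAint hΦ
  have hspec : operatorSpectrum (harmonicOperator T A)
      = {z | (Φ T).charpoly.IsRoot (exp (T * z))} := by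
    -- Every `z` is either an eigenvalue or in the resolvent set, so the spectrum is pure point
    -- spectrum.
    refine Set.Subset.antisymm (fun z hz => ?_) (hpoint ▸ operatorPointSpectrum_subset _)
    by_contra h
    exact hz (mem_operatorResolventSet_harmonicOperator hT hper hA hAint hΦ h)
  obtain ⟨lam, hlam⟩ := exists_isFloquetExponents hT.ne'
    fun v => hΦ.mulVec_injective hAint hper (T := T) (v := v)
  refine ⟨Φ, hΦ, fun Ψ hΨ => hΨ.unique hAint hΦ, ⟨lam, hlam⟩, fun lam' hlam' => ?_, ?_, fun z => ?_⟩
  · have h : {z | (Φ T).charpoly.IsRoot (exp (T * z))}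
        = {z | ∃ (p : Fin n) (k : ℤ), z = lam' p + I * angularFreq T * k} :=
      Set.ext (isRoot_charpoly_iff_exists hT hlam')
    exact ⟨hspec.trans h, hpoint.trans h⟩
  · rw [hspec]
    exact not_isBounded_floquet_lattice hT (lam ⟨0, hn⟩) fun k =>
      (isRoot_charpoly_iff_exists hT hlam _).2 ⟨_, k, rfl⟩
  · rw [hspec]
    exact not_accPt_of_exp_isRoot hT (Φ T).charpoly_monic.ne_zero z
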